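/- Let $\mathbb T=[t_0,t_1]$ with $t_0<t_1$. A linear time-varying system $$E\dot z=(J-R-EK)z+Gu,\qquad y=G^Tz \qquad (1)$$ with state $z(t)\in\mathbb R^n$, input $u(t)$ and output $y(t)\in\mathbb R^m$, $E\in C^1$ and $J,R,K,G$ continuous on $\mathbb T$, is called a pHDAE (with $Q=I$ and without feedthrough) if pointwise $E=E^T$, $\dot E=(EK-J)+(EK-J)^T$ and $R=R^T\ge 0$. Its Hamiltonian is $\mathcal H(t,z)=\tfrac12 z^TE(t)z$. A solution is a $C^1$ function $z$ satisfying the state equation pointwise on $\mathbb T$. Consider a pHDAE (1) of the reduced form $$E=\begin{bmatrix}E_1&0\\0&0\end{bmatrix},\quad J=\begin{bmatrix}J_1&0\\0&0\end{bmatrix},\quad R=\begin{bmatrix}R_1&0\\0&0\end{bmatrix},\quad K=\begin{bmatrix}K_1&0\\0&0\end{bmatrix},\quad G=\begin{bmatrix}G_1\\G_2\end{bmatrix}$$ with $n=n_1+n_2$ and non-negative Hamiltonian, where $J_1,R_1,G_1,G_2$ are continuously differentiable, $G_2(t)\in\mathbb R^{n_2\times m}$ has full row rank for every $t\in\mathbb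 T$, and the system $E_1\dot z_1=(J_1-R_1-E_1K_1)z_1+G_1u$ is regular: for every sufficiently often differentiable $u$ it has a solution, and a solution is uniquely determined by its initial value at $t_0$. For $t\in\mathbb T$ put $$\mathcal N(t)=\{x\in\ker E(t): y^T(J(t)-R(t))x=0\ \text{for all } y\in\ker E(t)\}.$$ Assume that the following numbers do not depend on $t$ (constant rank assumptions): $\operatorname{rank}E(t)$, $\dim\mathcal N(t)$, $\dim\big((J(t)-R(t))^T\mathcal N(t)\big)$ and $\dim\big(G(t)^T\mathcal N(t)\big)$. Then there are pointwise orthogonal $V\in C^1(\mathbb T,\mathbb R^{n,n})$ and $U\in C^1(\mathbb T,\mathbb R^{m,m})$, partitions of $n$ into six and of $m$ into three (possibly void) blocks, and a pHDAE $$\hat E\dot{\hat z}=(\hat J-\hat R-\hat E\hat K)\hat z+\hat G\hat u,\qquad \hat y=\hat G^T\hat z \qquad (2)$$ such that $(z,u,y)$ satisfies (1) if and only if $(\hat z,\hat u,\hat y)=(V^Tz,U^Tu,U^Ty)$ satisfies (2), with coefficients $$\hat E=V^TEV,\quad \hat R=V^TRV,\quad \hat G=V^TGU,\quad \hat J-\hat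 R-\hat E\hat K=V^T(J-R-EK)V-V^TE\dot V$$ (and $\hat J=V^TJV$ if $J$ is pointwise skew-symmetric), of the form $$\hat E=\begin{bmatrix}E_{11}&E_{12}&0&0&0&0\\E_{21}&E_{22}&0&0&0&0\\0&0&0&0&0&0\\0&0&0&0&0&0\\0&0&0&0&0&0\\0&0&0&0&0&0\end{bmatrix},\quad \hat G=\begin{bmatrix}G_{11}&G_{12}&G_{13}\\G_{21}&G_{22}&G_{23}\\G_{31}&G_{32}&G_{33}\\0&G_{42}&G_{43}\\0&0&G_{53}\\0&0&G_{63}\end{bmatrix},\quad \hat K=\begin{bmatrix}K_{11}&K_{12}&K_{13}&K_{14}&0&0\\K_{21}&K_{22}&K_{23}&K_{24}&0&0\\0&0&0&0&0&0\\0&0&0&0&0&0\\0&0&0&0&0&0\\0&0&0&0&0&0\end{bmatrix},$$ $$\hat J-\hat R=\begin{bmatrix}J_{11}-R_{11}&J_{12}-R_{12}&J_{13}-R_{13}&J_{14}&J_{15}&0\\J_{21}-R_{21}&J_{22}-R_{22}&J_{23}-R_{23}&J_{24}&0&0\\J_{31}-R_{31}&J_{32}-R_{32}&J_{33}-R_{33}&0&0&0\\J_{41}&J_{42}&0&0&0&0\\J_{51}&0&0&0&0&0\\0&0&0&0&0&0\end{bmatrix},$$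 where the blocks $J_{ij}$ of $\hat J$ and $R_{ij}$ of $\hat R$ that are not displayed vanish, and $E_{22}$, $J_{33}-R_{33}$, $J_{15}$, $G_{42}$ and $G_{63}$ are (square and) pointwise invertible. Consequently, every solution of (2) satisfies $\hat u_3=0$ and $\hat z_1=0$ on $\mathbb T$, and $\hat z_5$ is uniquely determined by $\hat u$ and the other components of $\hat z$; these are the parts that need regularization by output feedback. -/

import Mathlib

open Matrix

/-- A matrix function that is continuously differentiable on `T` (entrywise). -/
def MatC1On {m n : Type} (M : ℝ → Matrix m n ℝ) (T : Set ℝ) : Prop :=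
  ∀ i j, ContDiffOn ℝ 1 (fun t => M t i j) T

/-- The entrywise time derivative of a matrix function on `T` (one-sided at end points). -/
noncomputable def matDeriv {m n : Type} (M : ℝ → Matrix m n ℝ) (T : Set ℝ) (t : ℝ) :
    Matrix m n ℝ :=
  Matrix.of fun i j => derivWithin (fun s => M s i j) T t

/-- Coefficients of a linear time-varying system with `Q = I` and without feedthrough,
`E ż = (J - R - E K) z + G u`, `y = Gᵀ z`. -/
structure LTVSystem (n m : Type) where
  E : ℝ → Matrix n n ℝ
  J : ℝ → Matrix n n ℝ
  R : ℝ → Matrix n n ℝ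
  K : ℝ → Matrix n n ℝ
  G : ℝ → Matrix n m ℝ

namespace LTVSystem

/-- The coefficient `J - R - E K` of the state. -/
def A {n m : Type} [Fintype n] (s : LTVSystem n m) (t : ℝ) : Matrix n n ℝ :=
  s.J t - s.R t - s.E t * s.K t

/-- The system is a linear time-varying port-Hamiltonian descriptor system on `T` (with `Q = I`,
`P = 0`, `S = N = 0`): the operator `E d/dt - (J - E K)` is skew-adjoint and the dissipation
matrix is positive semidefinite. As usual in the time-varying case, `J` itself is not required
to be skew-symmetric. -/
structure IsPHDAE {n m : Type} [Fintype n] (s : LTVSystem n m) (T : Set ℝ) : Prop where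
  E_C1 : MatC1On s.E T
  J_cont : ContinuousOn s.J T
  R_cont : ContinuousOn s.R T
  K_cont : ContinuousOn s.K T
  G_cont : ContinuousOn s.G T
  E_symm : ∀ t ∈ T, (s.E t)ᵀ = s.E t
  skew_adjoint : ∀ t ∈ T,
    matDeriv s.E T t = (s.E t * s.K t - s.J t) + (s.E t * s.K t - s.J t)ᵀ
  R_psd : ∀ t ∈ T, (s.R t).PosSemidef

/-- The quadratic Hamiltonian `½ zᵀ E(t) z`. -/
noncomputable def hamiltonian {n m : Type} [Fintype n] (s : LTVSystem n m) (t : ℝ) (z : n → ℝ) :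
    ℝ :=
  (1 / 2) * (z ⬝ᵥ (s.E t *ᵥ z))

/-- `z` is a (classical, continuously differentiable) solution of the state equation on `T` for
the input `u`. -/
def IsStateSolution {n m : Type} [Fintype n] [Fintype m] (s : LTVSystem n m) (T : Set ℝ)
    (z : ℝ → n → ℝ) (u : ℝ → m → ℝ) : Prop :=
  ContDiffOn ℝ 1 z T ∧
    ∀ t ∈ T, s.E t *ᵥ derivWithin z T t = s.A t *ᵥ z t + s.G t *ᵥ u t

/-- `(z, u, y)` is a behavior solution on `T` (state and output equation). -/
def IsSolution {n m : Type} [Fintype n] [Fintype m] (s : LTVSystem n m) (T : Set ℝ)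
    (z : ℝ → n → ℝ) (u y : ℝ → m → ℝ) : Prop :=
  s.IsStateSolution T z u ∧ ∀ t ∈ T, y t = (s.G t)ᵀ *ᵥ z t

/-- Regularity on `[t₀, t₁]`: for every sufficiently smooth input the state equation is solvable,
and its solution is unique for every consistent initial value. -/
def IsRegular {n m : Type} [Fintype n] [Fintype m] (s : LTVSystem n m) (t₀ t₁ : ℝ) : Prop :=
  ∃ k : ℕ, ∀ u : ℝ → m → ℝ, ContDiffOn ℝ k u (Set.Icc t₀ t₁) →
    (∃ z, s.IsStateSolution (Set.Icc t₀ t₁) z u) ∧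
    ∀ z w, s.IsStateSolution (Set.Icc t₀ t₁) z u → s.IsStateSolution (Set.Icc t₀ t₁) w u →
      z t₀ = w t₀ → Set.EqOn z w (Set.Icc t₀ t₁)

/-- The system with state `(z₁, z₂)` in which `z₂` enters only through the input matrix:
`diag(E₁, 0) ż = diag(J₁ - R₁ - E₁ K₁, 0) z + [G₁; G₂] u`, `y = [G₁ᵀ G₂ᵀ] z`. -/
def augment {n₁ n₂ m : Type} (s : LTVSystem n₁ m) (G₂ : ℝ → Matrix n₂ m ℝ) :
    LTVSystem (n₁ ⊕ n₂) m where
  E t := fromBlocks (s.E t) 0 0 0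
  J t := fromBlocks (s.J t) 0 0 0
  R t := fromBlocks (s.R t) 0 0 0
  K t := fromBlocks (s.K t) 0 0 0
  G t := fromRows (s.G t) (G₂ t)

/-- The kernel of the compression of `J(t) - R(t)` to `ker E(t)`. If the columns of `Z` form a
basis of `ker E(t)`, it consists of the vectors `Z a` with `Zᵀ (J(t) - R(t)) Z a = 0`. -/
def algKernel {n m : Type} [Fintype n] (s : LTVSystem n m) (t : ℝ) : Submodule ℝ (n → ℝ) where
  carrier := {x | s.E t *ᵥ x = 0 ∧
    ∀ y, s.E t *ᵥ y = 0 → y ⬝ᵥ ((s.J t - s.R t) *ᵥ x) = 0}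
  zero_mem' := by simp
  add_mem' := by
    rintro a b ⟨ha, ha'⟩ ⟨hb, hb'⟩
    refine ⟨by rw [mulVec_add, ha, hb, add_zero], fun y hy => ?_⟩
    rw [mulVec_add, dotProduct_add, ha' y hy, hb' y hy, add_zero]
  smul_mem' := by
    rintro c a ⟨ha, ha'⟩
    refine ⟨by rw [mulVec_smul, ha, smul_zero], fun y hy => ?_⟩
    rw [mulVec_smul, dotProduct_smul, ha' y hy, smul_zero]

/-- The constant rank assumptions. With columns of `Z` a basis of `ker E`, and columns of `N` a
basis of `algKernel`, they say that the ranks of `E`, `Zᵀ (J - R) Z`, `Nᵀ (J - R)` and `Nᵀ G`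
do not depend on time. (The rank of `Zᵀ (J - R) Z` is the difference of the dimensions of `ker E`
and `algKernel`.) -/
def HasConstantRanks {n m : Type} [Fintype n] [Fintype m] (s : LTVSystem n m) (T : Set ℝ) :
    Prop :=
  ∃ r₁ r₂ r₃ r₄ : ℕ, ∀ t ∈ T,
    (s.E t).rank = r₁ ∧
    Module.finrank ℝ (s.algKernel t) = r₂ ∧
    Module.finrank ℝ ((s.algKernel t).map ((s.J t - s.R t)ᵀ).mulVecLin) = r₃ ∧
    Module.finrank ℝ ((s.algKernel t).map ((s.G t)ᵀ).mulVecLin) = r₄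

end LTVSystem

/-- Pointwise orthogonality on `T`. Rows and columns may carry different index types. -/
def IsOrthogonalOn {m n : Type} [Fintype m] [Fintype n] [DecidableEq m] [DecidableEq n]
    (V : ℝ → Matrix m n ℝ) (T : Set ℝ) : Prop :=
  ∀ t ∈ T, (V t)ᵀ * V t = 1 ∧ V t * (V t)ᵀ = 1

/-- Invertibility of a matrix whose rows and columns carry possibly different index types; it
forces the matrix to be square. -/
def IsInvertibleMatrix {m n : Type} [Fintype m] [Fintype n] [DecidableEq m] [DecidableEq n]
    (M : Matrix m n ℝ) : Prop :=
  ∃ B : Matrix n m ℝ, M * B = 1 ∧ B * M = 1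

/-- Index type of vectors that are partitioned into `k` blocks of sizes `d 0, …, d (k - 1)`
(possibly void). -/
abbrev BlockIdx {k : ℕ} (d : Fin k → ℕ) : Type := Σ i : Fin k, Fin (d i)

/-- The block of `M` in block row `i` and block column `j` (counted from `0`). -/
def blk {k l : ℕ} {d : Fin k → ℕ} {e : Fin l → ℕ} (M : Matrix (BlockIdx d) (BlockIdx e) ℝ)
    (i : Fin k) (j : Fin l) : Matrix (Fin (d i)) (Fin (e j)) ℝ :=
  Matrix.of fun a b => M ⟨i, a⟩ ⟨j, b⟩

/-- The blocks of `M` vanish wherever the pattern has a zero. -/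
def HasPattern {k l : ℕ} {d : Fin k → ℕ} {e : Fin l → ℕ} (M : Matrix (BlockIdx d) (BlockIdx e) ℝ)
    (pat : Matrix (Fin k) (Fin l) ℕ) : Prop :=
  ∀ i j, pat i j = 0 → blk M i j = 0

/-- Zero pattern of `E` in the condensed form. -/
def patternE : Matrix (Fin 6) (Fin 6) ℕ :=
  !![1, 1, 0, 0, 0, 0;
     1, 1, 0, 0, 0, 0;
     0, 0, 0, 0, 0, 0;
     0, 0, 0, 0, 0, 0;
     0, 0, 0, 0, 0, 0;
     0, 0, 0, 0, 0, 0]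

/-- Zero pattern of `J` in the condensed form. -/
def patternJ : Matrix (Fin 6) (Fin 6) ℕ :=
  !![1, 1, 1, 1, 1, 0;
     1, 1, 1, 1, 0, 0;
     1, 1, 1, 0, 0, 0;
     1, 1, 0, 0, 0, 0;
     1, 0, 0, 0, 0, 0;
     0, 0, 0, 0, 0, 0]

/-- Zero pattern of `R` in the condensed form. -/
def patternR : Matrix (Fin 6) (Fin 6) ℕ :=
  !![1, 1, 1, 0, 0, 0;
     1, 1, 1, 0, 0, 0;
     1, 1, 1, 0, 0, 0;
     0, 0, 0, 0, 0, 0;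
     0, 0, 0, 0, 0, 0;
     0, 0, 0, 0, 0, 0]

/-- Zero pattern of `K` in the condensed form. -/
def patternK : Matrix (Fin 6) (Fin 6) ℕ :=
  !![1, 1, 1, 1, 0, 0;
     1, 1, 1, 1, 0, 0;
     0, 0, 0, 0, 0, 0;
     0, 0, 0, 0, 0, 0;
     0, 0, 0, 0, 0, 0;
     0, 0, 0, 0, 0, 0]

/-- Zero pattern of `G` in the condensed form. -/
def patternG : Matrix (Fin 6) (Fin 3) ℕ :=
  !![1, 1, 1;
     1, 1, 1;
     1, 1, 1;
     0, 1, 1;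
     0, 0, 1;
     0, 0, 1]

/-- The six-block condensed form: zero patterns of the coefficients, and pointwise invertibility
of the blocks `E₂₂`, `J₃₃ - R₃₃`, `J₁₅`, `G₄₂` and `G₆₃` (in the usual numbering from `1`). -/
structure IsCondensedForm {d : Fin 6 → ℕ} {e : Fin 3 → ℕ}
    (c : LTVSystem (BlockIdx d) (BlockIdx e)) (T : Set ℝ) : Prop where
  E_pattern : ∀ t ∈ T, HasPattern (c.E t) patternE
  J_pattern : ∀ t ∈ T, HasPattern (c.J t) patternJ
  R_pattern : ∀ t ∈ T, HasPattern (c.R t) patternR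
  K_pattern : ∀ t ∈ T, HasPattern (c.K t) patternK
  G_pattern : ∀ t ∈ T, HasPattern (c.G t) patternG
  E22_inv : ∀ t ∈ T, IsInvertibleMatrix (blk (c.E t) 1 1)
  JR33_inv : ∀ t ∈ T, IsInvertibleMatrix (blk (c.J t - c.R t) 2 2)
  J15_inv : ∀ t ∈ T, IsInvertibleMatrix (blk (c.J t) 0 4)
  G42_inv : ∀ t ∈ T, IsInvertibleMatrix (blk (c.G t) 3 1)
  G63_inv : ∀ t ∈ T, IsInvertibleMatrix (blk (c.G t) 5 2)

/-- The coefficients of `c` are those of `s` after the change of variables `z = V ẑ`, `u = U û`,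
`y = U ŷ`, multiplying the state equation by `Vᵀ` and the output equation by `Uᵀ`. -/
structure IsCongruent {n m n' m' : Type} [Fintype n] [Fintype m] [Fintype n'] [Fintype m']
    (s : LTVSystem n m) (c : LTVSystem n' m') (V : ℝ → Matrix n n' ℝ) (U : ℝ → Matrix m m' ℝ)
    (T : Set ℝ) : Prop where
  E_eq : ∀ t ∈ T, c.E t = (V t)ᵀ * s.E t * V t
  R_eq : ∀ t ∈ T, c.R t = (V t)ᵀ * s.R t * V t
  A_eq : ∀ t ∈ T, c.A t = (V t)ᵀ * s.A t * V t - (V t)ᵀ * s.E t * matDeriv V T t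
  G_eq : ∀ t ∈ T, c.G t = (V t)ᵀ * s.G t * U t
  J_eq_of_skew : (∀ t ∈ T, (s.J t)ᵀ = -s.J t) → ∀ t ∈ T, c.J t = (V t)ᵀ * s.J t * V t

/-! The state blocks are the successive differences of a chain of subspaces: whole space ⊇ 𝒞 ⊇ ker E
⊇ 𝒩 ⊇ 𝒵 ⊕ 𝒜 ⊇ 𝒵 ⊇ 0. Here 𝒩 is `algKernel`, 𝒵 is the space of the second state component, 𝒜 is the
set of vectors in 𝒩 ⊖ 𝒵 whose image under Gᵀ lies in Gᵀ𝒵, and 𝒞 is the kernel of J - R followed by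
the projection onto 𝒜. The input blocks come in the same way from the kernel of G₂ and from the part
of it on which the rows of G belonging to 𝒩 ⊖ 𝒵 ⊖ 𝒜 vanish.

Zeros: differentiating E P = 0, with P the projection onto ker E, shows that J compressed to ker E
is skew (`ker_compression_skew`). Hence R vanishes on 𝒩, and the one-sided condition defining 𝒩
becomes two-sided. Invertible blocks: E₂₂ uses E ≥ 0, J₃₃ - R₃₃ the definition of 𝒩; each of the
others is injective off a kernel, and so is its transpose. For J₁₅ this needs 𝒩 ∩ ker (J - R)ᵀ = 𝒵,
which is where regularity enters: a C¹ curve in that intersection, multiplied by t - t₀, gives a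
homogeneous solution with zero initial value (`eq_zero_of_isRegular`).

Smoothness: for constant rank the kernel projection of M is an explicit polynomial in MᵀM
(`isKerProj_charpoly`), and Kato's transport turns a C¹ projection into a C¹ orthonormal frame
(`MatC1On.exists_frame`). The frames of all blocks side by side form V and U.

The port-Hamiltonian identity depends only on E, R and J - R - EK, so the transformed K may be cut
down to its leading blocks and the remainder moved into J (`condense`). -/

/-! ### Calculus of matrix functions -/

theorem MatC1On.mul {l m n : Type} [Fintype m] {M : ℝ → Matrix l m ℝ} {N : ℝ → Matrix m n ℝ}
    {T : Set ℝ} (hM : MatC1On M T) (hN : MatC1On N T) : MatC1On (fun t => M t * N t) T := by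
  intro i j
  simp only [Matrix.mul_apply]
  exact ContDiffOn.sum fun k _ => (hM i k).mul (hN k j)

theorem MatC1On.add {m n : Type} {M N : ℝ → Matrix m n ℝ} {T : Set ℝ}
    (hM : MatC1On M T) (hN : MatC1On N T) : MatC1On (fun t => M t + N t) T :=
  fun i j => (hM i j).add (hN i j)

theorem MatC1On.sub {m n : Type} {M N : ℝ → Matrix m n ℝ} {T : Set ℝ}
    (hM : MatC1On M T) (hN : MatC1On N T) : MatC1On (fun t => M t - N t) T :=
  fun i j => (hM i j).sub (hN i j)

theorem MatC1On.transpose {m n : Type} {M : ℝ → Matrix m n ℝ} {T : Set ℝ}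
    (hM : MatC1On M T) : MatC1On (fun t => (M t)ᵀ) T :=
  fun i j => hM j i

theorem MatC1On.const {m n : Type} (M : Matrix m n ℝ) (T : Set ℝ) : MatC1On (fun _ => M) T :=
  fun _ _ => contDiffOn_const

theorem MatC1On.fromRows {m₁ m₂ n : Type} {M : ℝ → Matrix m₁ n ℝ} {N : ℝ → Matrix m₂ n ℝ}
    {T : Set ℝ} (hM : MatC1On M T) (hN : MatC1On N T) :
    MatC1On (fun t => Matrix.fromRows (M t) (N t)) T := by
  rintro (i | i) j
  · exact hM i j
  · exact hN i j

theorem MatC1On.fromBlocks {m₁ m₂ n₁ n₂ : Type} {A : ℝ → Matrix m₁ n₁ ℝ} {B : ℝ → Matrix m₁ n₂ ℝ}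
    {C : ℝ → Matrix m₂ n₁ ℝ} {D : ℝ → Matrix m₂ n₂ ℝ} {T : Set ℝ}
    (hA : MatC1On A T) (hB : MatC1On B T) (hC : MatC1On C T) (hD : MatC1On D T) :
    MatC1On (fun t => Matrix.fromBlocks (A t) (B t) (C t) (D t)) T := by
  rintro (i | i) (j | j)
  · exact hA i j
  · exact hB i j
  · exact hC i j
  · exact hD i j

theorem MatC1On.differentiableWithinAt {m n : Type} {M : ℝ → Matrix m n ℝ} {T : Set ℝ}
    (hM : MatC1On M T) {t : ℝ} (ht : t ∈ T) (i : m) (j : n) :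
    DifferentiableWithinAt ℝ (fun s => M s i j) T t :=
  (hM i j).differentiableOn one_ne_zero t ht

theorem MatC1On.continuousOn {m n : Type} {M : ℝ → Matrix m n ℝ} {T : Set ℝ}
    (hM : MatC1On M T) : ContinuousOn M T :=
  continuousOn_pi.2 fun i => continuousOn_pi.2 fun j => (hM i j).continuousOn

theorem ContinuousOn.matrix_mul {l m n : Type} [Fintype m] {M : ℝ → Matrix l m ℝ}
    {N : ℝ → Matrix m n ℝ} {T : Set ℝ} (hM : ContinuousOn M T) (hN : ContinuousOn N T) :
    ContinuousOn (fun t => M t * N t) T :=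
  (continuous_fst.matrix_mul continuous_snd).comp_continuousOn (hM.prodMk hN)

theorem MatC1On.mulVec {m n : Type} [Fintype n] [Fintype m] {M : ℝ → Matrix m n ℝ}
    {z : ℝ → n → ℝ} {T : Set ℝ} (hM : MatC1On M T) (hz : ContDiffOn ℝ 1 z T) :
    ContDiffOn ℝ 1 (fun t => M t *ᵥ z t) T := by
  refine contDiffOn_pi.2 fun i => ?_
  simp only [Matrix.mulVec, dotProduct]
  exact ContDiffOn.sum fun k _ => (hM i k).mul (contDiffOn_pi.1 hz k)

theorem continuousOn_matDeriv {m n : Type} {M : ℝ → Matrix m n ℝ} {T : Set ℝ}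
    (hT : UniqueDiffOn ℝ T) (hM : MatC1On M T) : ContinuousOn (matDeriv M T) T :=
  continuousOn_pi.2 fun i => continuousOn_pi.2 fun j =>
    (hM i j).continuousOn_derivWithin hT le_rfl

theorem matDeriv_mul {l m n : Type} [Fintype m] {M : ℝ → Matrix l m ℝ} {N : ℝ → Matrix m n ℝ}
    {T : Set ℝ} (hM : MatC1On M T) (hN : MatC1On N T)
    {t : ℝ} (ht : t ∈ T) :
    matDeriv (fun t => M t * N t) T t = matDeriv M T t * N t + M t * matDeriv N T t := by
  ext i j
  simp only [matDeriv, Matrix.of_apply, Matrix.add_apply, Matrix.mul_apply]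
  rw [derivWithin_fun_sum fun k _ =>
    (hM.differentiableWithinAt ht i k).fun_mul (hN.differentiableWithinAt ht k j),
    ← Finset.sum_add_distrib]
  exact Finset.sum_congr rfl fun k _ => derivWithin_fun_mul
    (hM.differentiableWithinAt ht i k) (hN.differentiableWithinAt ht k j)

theorem matDeriv_transpose {m n : Type} (M : ℝ → Matrix m n ℝ) (T : Set ℝ) (t : ℝ) :
    matDeriv (fun t => (M t)ᵀ) T t = (matDeriv M T t)ᵀ := rfl

theorem matDeriv_congr {m n : Type} {M N : ℝ → Matrix m n ℝ} {T : Set ℝ}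
    (h : ∀ t ∈ T, M t = N t) {t : ℝ} (ht : t ∈ T) : matDeriv M T t = matDeriv N T t := by
  ext i j
  exact derivWithin_congr (fun s hs => by rw [h s hs]) (by rw [h t ht])

theorem matDeriv_const {m n : Type} (M : Matrix m n ℝ) (T : Set ℝ) (t : ℝ) :
    matDeriv (fun _ => M) T t = 0 := by
  ext i j
  simp [matDeriv]

theorem derivWithin_mulVec {m n : Type} [Fintype n] [Fintype m] {M : ℝ → Matrix m n ℝ}
    {z : ℝ → n → ℝ} {T : Set ℝ} (hM : MatC1On M T) (hz : ContDiffOn ℝ 1 z T) {t : ℝ} (ht : t ∈ T) :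
    derivWithin (fun t => M t *ᵥ z t) T t =
      matDeriv M T t *ᵥ z t + M t *ᵥ derivWithin z T t := by
  have hz' : ∀ k, DifferentiableWithinAt ℝ (fun s => z s k) T t := fun k =>
    (contDiffOn_pi.1 hz k).differentiableOn one_ne_zero t ht
  have hMz := (hM.mulVec hz).differentiableOn one_ne_zero t ht
  ext i
  rw [derivWithin_pi (differentiableWithinAt_pi.1 hMz), derivWithin_pi hz']
  simp only [Matrix.mulVec, dotProduct, Pi.add_apply, matDeriv, Matrix.of_apply]
  rw [derivWithin_fun_sum fun k _ => (hM.differentiableWithinAt ht i k).fun_mul (hz' k),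
    ← Finset.sum_add_distrib]
  exact Finset.sum_congr rfl fun k _ => derivWithin_fun_mul
    (hM.differentiableWithinAt ht i k) (hz' k)

/-- A matrix function with vanishing derivative on a compact interval is constant. -/
theorem eq_left_of_matDeriv_eq_zero {m n : Type} {M : ℝ → Matrix m n ℝ} {a b : ℝ}
    (hM : MatC1On M (Set.Icc a b)) (h : ∀ t ∈ Set.Icc a b, matDeriv M (Set.Icc a b) t = 0) :
    ∀ t ∈ Set.Icc a b, M t = M a := by
  intro t ht
  ext i j
  exact constant_of_derivWithin_zero ((hM i j).differentiableOn one_ne_zero)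
    (fun s hs => congrFun (congrFun (h s (Set.Ico_subset_Icc_self hs)) i) j) t ht

/-! ### Linear flows with skew coefficient -/

open scoped InnerProductSpace in
/-- Global solvability of a linear initial value problem with skew-adjoint coefficient. -/
theorem exists_solution_of_skew {H : Type} [NormedAddCommGroup H] [InnerProductSpace ℝ H]
    [FiniteDimensional ℝ H] {a b : ℝ} (hab : a ≤ b) {B : ℝ → H →L[ℝ] H}
    (hB : ContinuousOn B (Set.Icc a b))
    (hskew : ∀ t ∈ Set.Icc a b, ∀ x, ⟪x, B t x⟫_ℝ = 0) (x₀ : H) :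
    ∃ x : ℝ → H, x a = x₀ ∧
      ∀ t ∈ Set.Icc a b, HasDerivWithinAt x (B t (x t)) (Set.Icc a b) t := by
  have : ProperSpace H := FiniteDimensional.proper ℝ H
  have : CompleteSpace H := FiniteDimensional.complete ℝ H
  obtain ⟨C, hC⟩ := isCompact_Icc.exists_bound_of_continuousOn hB
  have hC0 : 0 ≤ C := (norm_nonneg _).trans (hC a (Set.left_mem_Icc.2 hab))
  -- The field is replaced by one composed with `h`, which is bounded by `c`, so Picard–Lindelöf
  -- reaches all of [a, b] at once with radius C c (b - a). By skewness the modified flow keeps the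
  -- norm equal to ‖x₀‖, and `h` is the identity on that sphere.
  let c : ℝ := 1 + ‖x₀‖ ^ 2
  have hc : 0 ≤ c := by positivity
  let h : H → H := fun x => (c * (1 + ‖x‖ ^ 2)⁻¹) • x
  have hpos : ∀ x : H, 0 < 1 + ‖x‖ ^ 2 := fun x => by positivity
  have h_smooth : ContDiff ℝ 1 h := by
    refine ContDiff.smul (contDiff_const.mul (ContDiff.inv ?_ fun x => (hpos x).ne')) contDiff_id
    exact contDiff_const.add (contDiff_norm_sq ℝ)
  have h_norm : ∀ x, ‖h x‖ ≤ c := by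
    intro x
    rw [norm_smul, Real.norm_of_nonneg (by have := hpos x; positivity), mul_assoc]
    refine mul_le_of_le_one_right hc ?_
    rw [inv_mul_le_one₀ (hpos x)]
    nlinarith [sq_nonneg (‖x‖ - 1), norm_nonneg x]
  let r : ℝ := C * c * (b - a)
  have hr : 0 ≤ r := by have := sub_nonneg.2 hab; positivity
  obtain ⟨Kh, hKh⟩ := LocallyLipschitzOn.exists_lipschitzOnWith_of_compact
    (isCompact_closedBall x₀ r) (h_smooth.locallyLipschitz.locallyLipschitzOn)
  have hPL : IsPicardLindelof (fun t x => B t (h x)) (tmin := a) (tmax := b)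
      ⟨a, Set.left_mem_Icc.2 hab⟩ x₀ ⟨r, hr⟩ 0 ⟨C * c, by positivity⟩ (⟨C, hC0⟩ * Kh) := by
    refine ⟨fun t ht => ?_, fun x _ => ?_, fun t ht x _ => ?_, ?_⟩
    · refine LipschitzWith.comp_lipschitzOnWith (g := h) (f := B t) ?_ hKh
      exact (B t).lipschitz.weaken (by exact_mod_cast hC t ht)
    · exact hB.clm_apply continuousOn_const
    · refine ((B t).le_opNorm _).trans ?_
      exact mul_le_mul (hC t ht) (h_norm x) (norm_nonneg _) hC0
    · simp only [NNReal.coe_zero, sub_zero, sub_self]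
      rw [max_eq_left (sub_nonneg.2 hab)]
      exact le_rfl
  obtain ⟨x, hx₀, hx⟩ := hPL.exists_eq_forall_mem_Icc_hasDerivWithinAt₀
  have hderiv : ∀ t ∈ Set.Icc a b,
      HasDerivWithinAt (fun t => ‖x t‖ ^ 2) 0 (Set.Icc a b) t := by
    intro t ht
    have := (hx t ht).norm_sq
    have h0 : ⟪x t, B t (h (x t))⟫_ℝ = 0 := by
      simp only [h, map_smul, inner_smul_right, hskew t ht, mul_zero]
    rwa [h0, mul_zero] at this
  have hconst : ∀ t ∈ Set.Icc a b, ‖x t‖ ^ 2 = ‖x₀‖ ^ 2 := by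
    intro t ht
    have := constant_of_has_deriv_right_zero (f := fun t => ‖x t‖ ^ 2)
      (fun s hs => (hderiv s hs).continuousWithinAt)
      (fun s hs => (hderiv s (Set.Ico_subset_Icc_self hs)).mono_of_mem_nhdsWithin
        (Icc_mem_nhdsGE_of_mem hs)) t ht
    simpa [hx₀] using this
  refine ⟨x, hx₀, fun t ht => ?_⟩
  have hh : h (x t) = x t := by
    simp only [h, hconst t ht, c]
    rw [mul_inv_cancel₀ (hpos x₀).ne', one_smul]
  simpa only [hh] using hx t ht

/-! ### Smooth projections onto kernels -/

/-- `P` is the matrix of the orthogonal projection onto the kernel of `M`. -/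
structure IsKerProj {m n : Type} [Fintype n] (P : Matrix n n ℝ) (M : Matrix m n ℝ) : Prop where
  symm : Pᵀ = P
  mul_eq_zero : M * P = 0
  apply_of_mem : ∀ x, M *ᵥ x = 0 → P *ᵥ x = x

/-- A symmetric matrix is diagonalizable, so the multiplicity of the root 0 equals the corank. -/
theorem Matrix.IsHermitian.charpoly_eq_X_pow_mul {n : Type} [Fintype n] [DecidableEq n]
    {S : Matrix n n ℝ} (hS : S.IsHermitian) :
    ∃ Q : Polynomial ℝ, S.charpoly = Polynomial.X ^ (Fintype.card n - S.rank) * Q ∧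
      Q.coeff 0 ≠ 0 := by
  classical
  refine ⟨∏ i with hS.eigenvalues i ≠ 0, (Polynomial.X - Polynomial.C (hS.eigenvalues i)), ?_, ?_⟩
  · rw [hS.charpoly_eq, ← Finset.prod_filter_mul_prod_filter_not Finset.univ
      (fun i => hS.eigenvalues i = 0)]
    congr 1
    rw [Finset.prod_congr rfl (g := fun _ => Polynomial.X) fun i hi => by
      simp [(Finset.mem_filter.1 hi).2], Finset.prod_const, hS.rank_eq_card_non_zero_eigs]
    congr 1
    rw [Fintype.card_subtype, ← Finset.card_univ,
      ← Finset.card_filter_add_card_filter_not (s := Finset.univ) (fun i => hS.eigenvalues i = 0)]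
    simp
  · rw [Polynomial.coeff_zero_eq_eval_zero, Polynomial.eval_prod, Finset.prod_ne_zero_iff]
    intro i hi
    simpa using (Finset.mem_filter.1 hi).2

theorem Matrix.transpose_mul_self_mulVec_eq_zero_iff {m n : Type} [Fintype m] [Fintype n]
    (M : Matrix m n ℝ) (x : n → ℝ) : (Mᵀ * M) *ᵥ x = 0 ↔ M *ᵥ x = 0 := by
  have := Matrix.conjTranspose_mul_self_mulVec_eq_zero M x
  rwa [Matrix.conjTranspose_eq_transpose_of_trivial] at this

theorem Matrix.transpose_mul_self_mul_eq_zero_iff {l m n : Type} [Fintype m] [Fintype n]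
    (M : Matrix m n ℝ) (N : Matrix n l ℝ) : (Mᵀ * M) * N = 0 ↔ M * N = 0 := by
  have := Matrix.conjTranspose_mul_self_mul_eq_zero M N
  rwa [Matrix.conjTranspose_eq_transpose_of_trivial] at this

/-- For symmetric S, S² Y = SᵀS Y = 0 forces S Y = 0, so the exponent can be lowered one at a time
down to 1. -/
theorem mul_eq_zero_of_pow_mul_eq_zero {n : Type} [Fintype n] [DecidableEq n] {S X : Matrix n n ℝ}
    (hS : Sᵀ = S) : ∀ k : ℕ, S ^ k * X = 0 → S * X = 0 := by
  intro k
  induction k with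
  | zero => intro h; rw [pow_zero, one_mul] at h; rw [h, mul_zero]
  | succ k ih =>
    intro h
    rcases k with _ | k
    · simpa using h
    · refine ih ?_
      rw [pow_succ'] at h ⊢
      rw [mul_assoc] at h ⊢
      rw [pow_succ', mul_assoc, ← mul_assoc] at h
      have := Matrix.transpose_mul_self_mul_eq_zero_iff S (S ^ k * X)
      rw [hS] at this
      exact this.1 h

/-- With S = MᵀM and χ = X^k Q, Q(0) ≠ 0, the projection is Q(S) / Q(0): Cayley–Hamilton gives S^k
Q(S) = 0, hence S Q(S) = 0, and Q(S) acts as Q(0) on ker S = ker M. The sum is Q(S), padded with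
vanishing coefficients so that its range depends on the size of the matrix alone; this explicit form
is what makes smoothness in t visible. -/
theorem isKerProj_charpoly {m n : Type} [Fintype m] [Fintype n] [DecidableEq n]
    (M : Matrix m n ℝ) {k : ℕ} (hk : k = Fintype.card n - M.rank) :
    ((Mᵀ * M).charpoly.coeff k ≠ 0) ∧
    IsKerProj (((Mᵀ * M).charpoly.coeff k)⁻¹ • ∑ j ∈ Finset.range (Fintype.card n + 1),
      (Mᵀ * M).charpoly.coeff (j + k) • (Mᵀ * M) ^ j) M := by
  set S := Mᵀ * M with hSdef
  have hSt : Sᵀ = S := by rw [hSdef, transpose_mul, transpose_transpose]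
  have hS : S.IsHermitian := by
    rw [Matrix.IsHermitian, Matrix.conjTranspose_eq_transpose_of_trivial, hSt]
  obtain ⟨Q, hQ, hQ0⟩ := hS.charpoly_eq_X_pow_mul
  have hrank : S.rank = M.rank := Matrix.rank_transpose_mul_self M
  rw [hrank, ← hk] at hQ
  have hcoeff : ∀ j, S.charpoly.coeff (j + k) = Q.coeff j := fun j => by
    rw [hQ, Polynomial.coeff_X_pow_mul]
  have hcoeff0 : S.charpoly.coeff k = Q.coeff 0 := by simpa using hcoeff 0
  have hQne : Q ≠ 0 := by rintro rfl; simp at hQ0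
  have hdeg : Q.natDegree < Fintype.card n + 1 := by
    have := congrArg Polynomial.natDegree hQ
    rw [Matrix.charpoly_natDegree_eq_dim, Polynomial.natDegree_mul
      (pow_ne_zero _ Polynomial.X_ne_zero) hQne] at this
    omega
  have hsum : ∑ j ∈ Finset.range (Fintype.card n + 1), S.charpoly.coeff (j + k) • S ^ j =
      Polynomial.aeval S Q := by
    rw [Polynomial.aeval_eq_sum_range' hdeg]
    simp only [hcoeff]
  rw [hsum, hcoeff0]
  refine ⟨hQ0, ?_, ?_, ?_⟩
  · rw [transpose_smul, Polynomial.aeval_eq_sum_range, transpose_sum]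
    simp only [transpose_smul, transpose_pow, hSt]
  · rw [Matrix.mul_smul]
    refine smul_eq_zero_of_right _ ?_
    rw [← Matrix.transpose_mul_self_mul_eq_zero_iff]
    refine mul_eq_zero_of_pow_mul_eq_zero hSt k ?_
    have := Matrix.aeval_self_charpoly S
    rwa [hQ, map_mul, map_pow, Polynomial.aeval_X] at this
  · intro x hx
    have hSx : S *ᵥ x = 0 := (Matrix.transpose_mul_self_mulVec_eq_zero_iff M x).2 hx
    have : Polynomial.aeval S Q *ᵥ x = Q.coeff 0 • x := by
      conv_lhs => rw [← Polynomial.divX_mul_X_add Q]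
      rw [map_add, map_mul, Polynomial.aeval_X, Polynomial.aeval_C, Matrix.add_mulVec,
        ← Matrix.mulVec_mulVec, hSx, Matrix.mulVec_zero, zero_add, Algebra.algebraMap_eq_smul_one,
        Matrix.smul_mulVec, Matrix.one_mulVec]
    rw [Matrix.smul_mulVec, this, smul_smul, inv_mul_cancel₀ hQ0, one_smul]

/-- The coefficients are universal polynomials in the matrix entries. -/
theorem contDiffOn_charpoly_coeff {n : Type} [Fintype n] [DecidableEq n] {S : ℝ → Matrix n n ℝ}
    {T : Set ℝ} (hS : MatC1On S T) (k : ℕ) :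
    ContDiffOn ℝ 1 (fun t => (S t).charpoly.coeff k) T := by
  have key : ∀ p : MvPolynomial (n × n) ℝ,
      ContDiffOn ℝ 1 (fun t => MvPolynomial.eval (fun ij => S t ij.1 ij.2) p) T := by
    intro p
    induction p using MvPolynomial.induction_on with
    | C a => simpa using contDiffOn_const
    | add p q hp hq => simpa using hp.add hq
    | mul_X p i hp => simpa using hp.mul (hS i.1 i.2)
  refine (key ((Matrix.charpoly.univ ℝ n).coeff k)).congr fun t _ => ?_
  exact (Matrix.charpoly.univ_coeff_eval₂Hom (R := ℝ) n (RingHom.id ℝ)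
    (fun ij => S t ij.1 ij.2) k).symm

theorem MatC1On.pow {n : Type} [Fintype n] [DecidableEq n] {S : ℝ → Matrix n n ℝ}
    {T : Set ℝ} (hS : MatC1On S T) (k : ℕ) : MatC1On (fun t => S t ^ k) T := by
  induction k with
  | zero => simpa using MatC1On.const 1 T
  | succ k ih => simpa only [pow_succ] using ih.mul hS

/-- The orthogonal projection onto the kernel of a `C¹` matrix function of constant rank
is `C¹`. -/
theorem MatC1On.exists_isKerProj {m n : Type} [Fintype m] [Fintype n] [DecidableEq n]
    {M : ℝ → Matrix m n ℝ} {T : Set ℝ} (hM : MatC1On M T) {r : ℕ}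
    (hr : ∀ t ∈ T, (M t).rank = r) :
    ∃ P : ℝ → Matrix n n ℝ, MatC1On P T ∧ ∀ t ∈ T, IsKerProj (P t) (M t) := by
  have hS : MatC1On (fun t => (M t)ᵀ * M t) T := hM.transpose.mul hM
  have hP := fun t ht => isKerProj_charpoly (M t)
    (k := Fintype.card n - r) (by rw [hr t ht])
  refine ⟨_, fun i j => ?_, fun t ht => (hP t ht).2⟩
  simp only [Matrix.smul_apply, Matrix.sum_apply, smul_eq_mul]
  refine ContDiffOn.mul ((contDiffOn_charpoly_coeff hS _).inv fun t ht => (hP t ht).1) ?_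
  exact ContDiffOn.sum fun l _ => (contDiffOn_charpoly_coeff hS _).mul (hS.pow l i j)

/-! ### Smooth orthonormal frames -/

/-- An orthogonal projection factors through an orthonormal basis of its range. -/
theorem exists_frame {n : Type} [Fintype n] [DecidableEq n] {P : Matrix n n ℝ}
    (hsymm : Pᵀ = P) (hidem : P * P = P) :
    ∃ (d : ℕ) (F : Matrix n (Fin d) ℝ), Fᵀ * F = 1 ∧ F * Fᵀ = P := by
  let W : Submodule ℝ (EuclideanSpace ℝ n) := LinearMap.range P.toEuclideanLin
  let b := stdOrthonormalBasis ℝ W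
  let F : Matrix n (Fin (Module.finrank ℝ W)) ℝ := Matrix.of fun i k => (b k : EuclideanSpace ℝ n) i
  have hcol : ∀ k, P *ᵥ (fun i => F i k) = fun i => F i k := by
    intro k
    obtain ⟨y, hy⟩ := (b k).2
    have : (fun i => F i k) = P *ᵥ y.ofLp := by
      ext i
      exact (congrFun (congrArg WithLp.ofLp hy) i).symm
    rw [this, mulVec_mulVec, hidem]
  have hPF : P * F = F := by
    ext i k
    exact congrFun (hcol k) i
  have hFF : Fᵀ * F = 1 := by
    ext k l
    have := orthonormal_iff_ite.1 b.orthonormal l k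
    rw [Submodule.coe_inner, PiLp.inner_apply] at this
    rw [Matrix.one_apply, Matrix.mul_apply]
    simp only [eq_comm (a := k)]
    exact this
  refine ⟨_, F, hFF, ?_⟩
  have hFP : F * Fᵀ * P = P := by
    ext i j
    let y : W := ⟨P.toEuclideanLin (EuclideanSpace.single j 1), LinearMap.mem_range_self _ _⟩
    have hy := congrArg (fun v : W => (v : EuclideanSpace ℝ n) i) (b.sum_repr' y)
    have hyP : ∀ a, (y : EuclideanSpace ℝ n) a = P a j := by
      intro a
      simp [y, Matrix.toLpLin_apply]
    simp only [Submodule.coe_inner, PiLp.inner_apply] at hy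
    simp only [hyP, Submodule.coe_sum, Submodule.coe_smul, WithLp.ofLp_sum, Finset.sum_apply,
      WithLp.ofLp_smul, Pi.smul_apply, smul_eq_mul] at hy
    rw [← hy, Matrix.mul_assoc]
    simp [Matrix.mul_apply, F, mul_comm]
  calc F * Fᵀ = (F * Fᵀ * P)ᵀ := by
        rw [transpose_mul, transpose_mul, transpose_transpose, hsymm, ← Matrix.mul_assoc, hPF]
    _ = P := by rw [hFP, hsymm]

theorem exists_orthogonal_flow {n : Type} [Fintype n] [DecidableEq n] {a b : ℝ} (hab : a < b)
    {B : ℝ → Matrix n n ℝ} (hB : ContinuousOn B (Set.Icc a b))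
    (hskew : ∀ t ∈ Set.Icc a b, (B t)ᵀ = -B t) :
    ∃ W : ℝ → Matrix n n ℝ, MatC1On W (Set.Icc a b) ∧ W a = 1 ∧
      (∀ t ∈ Set.Icc a b, matDeriv W (Set.Icc a b) t = B t * W t) ∧
      ∀ t ∈ Set.Icc a b, (W t)ᵀ * W t = 1 ∧ W t * (W t)ᵀ = 1 := by
  have hT := uniqueDiffOn_Icc hab
  let L : Matrix n n ℝ →ₗ[ℝ] (EuclideanSpace ℝ n →L[ℝ] EuclideanSpace ℝ n) :=
    LinearMap.toContinuousLinearMap.toLinearMap ∘ₗ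
      (Matrix.toEuclideanLin (𝕜 := ℝ) (m := n) (n := n)).toLinearMap
  have hL : ∀ M x i, (L M x) i = (M *ᵥ x.ofLp) i := fun M x i => rfl
  have hLB : ContinuousOn (fun t => L (B t)) (Set.Icc a b) :=
    (LinearMap.continuous_of_finiteDimensional L).comp_continuousOn hB
  have hLskew : ∀ t ∈ Set.Icc a b, ∀ x, inner ℝ x (L (B t) x) = 0 := by
    intro t ht x
    have h1 : inner ℝ x (L (B t) x) = x.ofLp ⬝ᵥ (B t *ᵥ x.ofLp) := by
      rw [PiLp.inner_apply]
      simp [dotProduct, hL, mul_comm]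
    have h2 : x.ofLp ⬝ᵥ (B t *ᵥ x.ofLp) = - (x.ofLp ⬝ᵥ (B t *ᵥ x.ofLp)) := by
      conv_lhs => rw [dotProduct_mulVec, ← mulVec_transpose, hskew t ht, neg_mulVec,
        neg_dotProduct, dotProduct_comm]
    rw [h1]; linarith
  -- The columns of `W` are the solutions that start at the standard basis vectors.
  choose x hx0 hx using fun j : n =>
    exists_solution_of_skew hab.le hLB hLskew (EuclideanSpace.single j (1 : ℝ))
  let W : ℝ → Matrix n n ℝ := fun t => Matrix.of fun i j => x j t i
  have hWd : ∀ i j, ∀ t ∈ Set.Icc a b,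
      HasDerivWithinAt (fun s => W s i j) ((B t * W t) i j) (Set.Icc a b) t := by
    intro i j t ht
    have h := ((EuclideanSpace.proj (𝕜 := ℝ) i).hasFDerivAt.comp_hasDerivWithinAt t (hx j t ht))
    exact h
  have hWc : ContinuousOn W (Set.Icc a b) := continuousOn_pi.2 fun i => continuousOn_pi.2 fun j =>
    fun t ht => (hWd i j t ht).continuousWithinAt
  have hWder : ∀ t ∈ Set.Icc a b, matDeriv W (Set.Icc a b) t = B t * W t := by
    intro t ht
    ext i j
    exact (hWd i j t ht).derivWithin (hT t ht)
  have hW1 : MatC1On W (Set.Icc a b) := by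
    intro i j
    rw [contDiffOn_one_iff_derivWithin hT]
    refine ⟨fun t ht => (hWd i j t ht).differentiableWithinAt, ?_⟩
    have : ContinuousOn (fun t => (B t * W t) i j) (Set.Icc a b) := by
      simp only [Matrix.mul_apply]
      exact continuousOn_finsetSum _ fun k _ =>
        (continuousOn_pi.1 (continuousOn_pi.1 hB i) k).mul
          (continuousOn_pi.1 (continuousOn_pi.1 hWc k) j)
    exact this.congr fun t ht => (hWd i j t ht).derivWithin (hT t ht)
  have hWa : W a = 1 := by
    ext i j
    simp [W, hx0, Matrix.one_apply]
  refine ⟨W, hW1, hWa, hWder, fun t ht => ?_⟩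
  -- The derivative of WᵀW is Wᵀ(Bᵀ + B)W = 0.
  have hconst := eq_left_of_matDeriv_eq_zero (hW1.transpose.mul hW1) (fun s hs => by
    rw [matDeriv_mul hW1.transpose hW1 hs, matDeriv_transpose, hWder s hs, transpose_mul,
      hskew s hs]
    simp [mul_assoc]) t ht
  have h1 : (W t)ᵀ * W t = 1 := by simpa [hWa] using hconst
  exact ⟨h1, mul_eq_one_comm.1 h1⟩

/-- The range of a `C¹` orthogonal projection on a compact interval has a `C¹` orthonormal basis. -/
theorem MatC1On.exists_frame {n : Type} [Fintype n] [DecidableEq n] {a b : ℝ} (hab : a < b)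
    {P : ℝ → Matrix n n ℝ} (hP : MatC1On P (Set.Icc a b))
    (hsymm : ∀ t ∈ Set.Icc a b, (P t)ᵀ = P t) (hidem : ∀ t ∈ Set.Icc a b, P t * P t = P t) :
    ∃ (d : ℕ) (F : ℝ → Matrix n (Fin d) ℝ), MatC1On F (Set.Icc a b) ∧
      ∀ t ∈ Set.Icc a b, (F t)ᵀ * F t = 1 ∧ F t * (F t)ᵀ = P t := by
  have hT := uniqueDiffOn_Icc hab
  have ha := Set.left_mem_Icc.2 hab.le
  let P' : ℝ → Matrix n n ℝ := matDeriv P (Set.Icc a b)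
  have hP'c : ContinuousOn P' (Set.Icc a b) := continuousOn_matDeriv hT hP
  have hP's : ∀ t ∈ Set.Icc a b, (P' t)ᵀ = P' t := by
    intro t ht
    rw [← matDeriv_transpose]
    exact matDeriv_congr hsymm ht
  have hP'i : ∀ t ∈ Set.Icc a b, P' t * P t + P t * P' t = P' t := by
    intro t ht
    rw [← matDeriv_mul hP hP ht]
    exact matDeriv_congr hidem ht
  have hPP'P : ∀ t ∈ Set.Icc a b, P t * P' t * P t = 0 := by
    intro t ht
    have h := congrArg (fun X => P t * X * P t) (hP'i t ht)
    simp only [mul_add, add_mul] at h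
    rw [← mul_assoc (P t) (P t), hidem t ht, mul_assoc (P t) _ (P t), mul_assoc (P' t), hidem t ht,
      ← mul_assoc] at h
    simpa using h
  -- Kato's transport: the flow of the commutator [P', P], which is skew because P and P' are
  -- symmetric, carries range P(a) to range P(t). Equivalently WᵀPW is constant, which rests on P P'
  -- P = 0 and P' = P'P + PP'.
  obtain ⟨W, hW, hWa, hW', hWo⟩ := exists_orthogonal_flow hab
    (B := fun t => P' t * P t - P t * P' t)
    ((hP'c.matrix_mul hP.continuousOn).sub (hP.continuousOn.matrix_mul hP'c))
    (fun t ht => by rw [transpose_sub, transpose_mul, transpose_mul, hsymm t ht, hP's t ht]; abel)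
  have hconst : ∀ t ∈ Set.Icc a b, (W t)ᵀ * (P t * W t) = P a := by
    intro t ht
    refine (eq_left_of_matDeriv_eq_zero (hW.transpose.mul (hP.mul hW)) (fun s hs => ?_) t ht).trans
      (by simp [hWa])
    rw [matDeriv_mul hW.transpose (hP.mul hW) hs, matDeriv_transpose, matDeriv_mul hP hW hs,
      hW' s hs, transpose_mul, transpose_sub, transpose_mul, transpose_mul, hsymm s hs, hP's s hs]
    have key : (P s * P' s - P' s * P s) * P s + P' s + P s * (P' s * P s - P s * P' s) = 0 := by
      rw [sub_mul, mul_sub, hPP'P s hs, ← mul_assoc (P s), hPP'P s hs, mul_assoc (P' s),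
        ← mul_assoc (P s) (P s), hidem s hs]
      nth_rewrite 2 [← hP'i s hs]
      abel
    calc _ = (W s)ᵀ * (((P s * P' s - P' s * P s) * P s + P' s +
          P s * (P' s * P s - P s * P' s)) * W s) := by
          simp only [P', mul_add, add_mul, mul_assoc]; abel
      _ = 0 := by rw [key]; simp
  obtain ⟨d, F, hF1, hF2⟩ := _root_.exists_frame (hsymm a ha) (hidem a ha)
  refine ⟨d, fun t => W t * F, hW.mul (MatC1On.const F _), fun t ht => ⟨?_, ?_⟩⟩ <;> dsimp only
  · rw [transpose_mul, Matrix.mul_assoc, ← Matrix.mul_assoc _ (W t), (hWo t ht).1, Matrix.one_mul, hF1]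
  · rw [transpose_mul, Matrix.mul_assoc, ← Matrix.mul_assoc F, hF2, ← hconst t ht]
    simp only [← mul_assoc]
    rw [(hWo t ht).2, one_mul, mul_assoc, (hWo t ht).2, mul_one]

/-! ### Ranks, kernels and kernel projections -/

section RankHelpers

variable {m n : Type} [Fintype n]

theorem finrank_inf_ker_add_finrank_map {V W : Type} [AddCommGroup V] [Module ℝ V]
    [FiniteDimensional ℝ V] [AddCommGroup W] [Module ℝ W] (S : Submodule ℝ V) (f : V →ₗ[ℝ] W) :
    Module.finrank ℝ (S.map f) + Module.finrank ℝ ↥(S ⊓ LinearMap.ker f) = Module.finrank ℝ S := by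
  have h := (f.domRestrict S).finrank_range_add_finrank_ker
  rw [LinearMap.range_domRestrict, LinearMap.ker_domRestrict] at h
  rw [← h, ← Submodule.map_comap_subtype,
    (Submodule.equivMapOfInjective _ S.injective_subtype _).finrank_eq]

theorem rank_add_finrank_ker (M : Matrix m n ℝ) :
    M.rank + Module.finrank ℝ (LinearMap.ker M.mulVecLin) = Fintype.card n := by
  have h := M.mulVecLin.finrank_range_add_finrank_ker
  rwa [Module.finrank_fintype_fun_eq_card] at h

theorem rank_eq_of_mulVec_eq_zero_iff {l : Type} {M : Matrix m n ℝ} {N : Matrix l n ℝ}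
    (h : ∀ x, M *ᵥ x = 0 ↔ N *ᵥ x = 0) : M.rank = N.rank := by
  have hk : LinearMap.ker M.mulVecLin = LinearMap.ker N.mulVecLin := by
    ext x
    exact h x
  have h1 := rank_add_finrank_ker M
  have h2 := rank_add_finrank_ker N
  rw [hk] at h1
  omega

theorem fromRows_mulVec_eq_zero_iff {l : Type} (M : Matrix m n ℝ) (N : Matrix l n ℝ)
    (x : n → ℝ) : Matrix.fromRows M N *ᵥ x = 0 ↔ M *ᵥ x = 0 ∧ N *ᵥ x = 0 := by
  rw [Matrix.fromRows_mulVec, funext_iff, Sum.forall, funext_iff, funext_iff]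
  rfl

theorem MatC1On.exists_isKerProj_of_finrank [DecidableEq n] [Fintype m]
    {M : ℝ → Matrix m n ℝ} {T : Set ℝ} (hM : MatC1On M T) {k : ℕ}
    (hk : ∀ t ∈ T, Module.finrank ℝ (LinearMap.ker (M t).mulVecLin) = k) :
    ∃ P : ℝ → Matrix n n ℝ, MatC1On P T ∧ ∀ t ∈ T, IsKerProj (P t) (M t) :=
  hM.exists_isKerProj (r := Fintype.card n - k) fun t ht => by
    have := rank_add_finrank_ker (M t)
    rw [hk t ht] at this
    omega

/-- The rank of a `C¹` orthogonal projection on a compact interval is constant. -/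
theorem MatC1On.exists_rank_eq [DecidableEq n] {a b : ℝ} (hab : a < b)
    {P : ℝ → Matrix n n ℝ} (hP : MatC1On P (Set.Icc a b))
    (hsymm : ∀ t ∈ Set.Icc a b, (P t)ᵀ = P t) (hidem : ∀ t ∈ Set.Icc a b, P t * P t = P t) :
    ∃ r, ∀ t ∈ Set.Icc a b, (P t).rank = r := by
  obtain ⟨d, F, -, hF⟩ := hP.exists_frame hab hsymm hidem
  refine ⟨d, fun t ht => ?_⟩
  rw [← (hF t ht).2, Matrix.rank_self_mul_transpose, ← Matrix.rank_transpose_mul_self,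
    (hF t ht).1, Matrix.rank_one, Fintype.card_fin]

variable {P : Matrix n n ℝ} {M : Matrix m n ℝ}

theorem IsKerProj.mul_of_mul_eq_zero {l : Type} (h : IsKerProj P M) {X : Matrix n l ℝ}
    (hX : M * X = 0) : P * X = X := by
  ext i j
  refine congrFun (h.apply_of_mem (fun k => X k j) ?_) i
  ext k
  exact congrFun (congrFun hX k) j

theorem IsKerProj.idem (h : IsKerProj P M) : P * P = P := h.mul_of_mul_eq_zero h.mul_eq_zero

theorem IsKerProj.apply_eq_iff (h : IsKerProj P M) (x : n → ℝ) : P *ᵥ x = x ↔ M *ᵥ x = 0 :=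
  ⟨fun hx => by rw [← hx, mulVec_mulVec, h.mul_eq_zero, zero_mulVec], h.apply_of_mem x⟩

/-- The kernel of P is the orthogonal complement of ker M, which is the range of Mᵀ; one inclusion
and a dimension count suffice. -/
theorem IsKerProj.exists_transpose_mulVec_eq [Fintype m] [DecidableEq n] (h : IsKerProj P M)
    {v : n → ℝ} (hv : P *ᵥ v = 0) : ∃ w, v = Mᵀ *ᵥ w := by
  have hPM : P * Mᵀ = 0 := by
    rw [← h.symm, ← transpose_mul, h.mul_eq_zero, transpose_zero]
  have hle : LinearMap.range (Mᵀ).mulVecLin ≤ LinearMap.ker P.mulVecLin := by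
    rintro _ ⟨w, rfl⟩
    rw [LinearMap.mem_ker, mulVecLin_apply, mulVecLin_apply, mulVec_mulVec, hPM, zero_mulVec]
  have hrange : LinearMap.range P.mulVecLin = LinearMap.ker M.mulVecLin := by
    ext x
    refine ⟨?_, fun hx => ⟨x, h.apply_of_mem x hx⟩⟩
    rintro ⟨w, rfl⟩
    simp [mulVec_mulVec, h.mul_eq_zero]
  have heq := Submodule.eq_of_le_of_finrank_eq hle (by
    have h1 := rank_add_finrank_ker M
    have h2 := rank_add_finrank_ker P
    have h3 : P.rank = Module.finrank ℝ (LinearMap.ker M.mulVecLin) := by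
      rw [← hrange, Matrix.rank]
    have h4 : Module.finrank ℝ (LinearMap.range (Mᵀ).mulVecLin) = M.rank := rank_transpose M
    omega)
  have hv' : v ∈ LinearMap.ker P.mulVecLin := hv
  rw [← heq] at hv'
  obtain ⟨w, hw⟩ := hv'
  exact ⟨w, hw.symm⟩

end RankHelpers

/-! ### Port-Hamiltonian structure on the kernel of E -/

namespace LTVSystem

variable {n m : Type} [Fintype n] {s : LTVSystem n m} {T : Set ℝ}

/-- Differentiating E P = 0 gives E'P = -E P', and P E = 0 kills the right-hand side after
multiplication by P. -/
theorem IsPHDAE.transpose_mul_deriv_mul_eq_zero {P : ℝ → Matrix n n ℝ}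
    (hs : s.IsPHDAE T) (hP : MatC1On P T)
    (hker : ∀ t ∈ T, IsKerProj (P t) (s.E t)) {t : ℝ} (ht : t ∈ T) :
    P t * matDeriv s.E T t * P t = 0 := by
  have h := matDeriv_congr (N := fun _ => (0 : Matrix n n ℝ))
    (fun r hr => (hker r hr).mul_eq_zero) ht
  rw [matDeriv_mul hs.E_C1 hP ht, matDeriv_const] at h
  have hPE : P t * s.E t = 0 := by
    have := congrArg Matrix.transpose (hker t ht).mul_eq_zero
    rwa [transpose_mul, (hker t ht).symm, hs.E_symm t ht, transpose_zero] at this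
  rw [mul_assoc, eq_neg_of_add_eq_zero_left h, mul_neg, ← mul_assoc, hPE, zero_mul, neg_zero]

/-- The compression of `J` to the kernel of `E` is skew-symmetric. -/
theorem IsPHDAE.ker_compression_skew {P : ℝ → Matrix n n ℝ}
    (hs : s.IsPHDAE T) (hP : MatC1On P T)
    (hker : ∀ t ∈ T, IsKerProj (P t) (s.E t)) {t : ℝ} (ht : t ∈ T) :
    P t * (s.J t + (s.J t)ᵀ) * P t = 0 := by
  have h := hs.transpose_mul_deriv_mul_eq_zero hP hker ht
  have hEP := (hker t ht).mul_eq_zero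
  have hPE : P t * s.E t = 0 := by
    have := congrArg Matrix.transpose hEP
    rwa [transpose_mul, (hker t ht).symm, hs.E_symm t ht, transpose_zero] at this
  rw [hs.skew_adjoint t ht, transpose_sub, transpose_mul, hs.E_symm t ht] at h
  have h1 : P t * (s.E t * s.K t - s.J t + ((s.K t)ᵀ * s.E t - (s.J t)ᵀ)) * P t =
      P t * s.E t * s.K t * P t + P t * (s.K t)ᵀ * (s.E t * P t) -
        P t * (s.J t + (s.J t)ᵀ) * P t := by noncomm_ring
  rw [h1, hPE, hEP] at h
  simpa using h

/-- On ker E the quadratic form of J vanishes by skewness, so xᵀRx = 0, and R ≥ 0 gives Rx = 0.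
Applied to every vector of `algKernel`. -/
theorem IsPHDAE.R_mulVec_eq_zero {P : ℝ → Matrix n n ℝ}
    (hs : s.IsPHDAE T) (hP : MatC1On P T)
    (hker : ∀ t ∈ T, IsKerProj (P t) (s.E t)) {t : ℝ} (ht : t ∈ T) {x : n → ℝ}
    (hEx : s.E t *ᵥ x = 0) (hx : x ⬝ᵥ ((s.J t - s.R t) *ᵥ x) = 0) : s.R t *ᵥ x = 0 := by
  have hPx := (hker t ht).apply_of_mem x hEx
  have h1 : x ⬝ᵥ ((s.J t + (s.J t)ᵀ) *ᵥ x) = 0 := by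
    have h := congrArg (fun X => x ⬝ᵥ (X *ᵥ x)) (hs.ker_compression_skew hP hker ht)
    simp only [← mulVec_mulVec, hPx, zero_mulVec, dotProduct_zero] at h
    rwa [dotProduct_mulVec, ← mulVec_transpose, (hker t ht).symm, hPx] at h
  have h2 : x ⬝ᵥ ((s.J t)ᵀ *ᵥ x) = x ⬝ᵥ (s.J t *ᵥ x) := by
    rw [dotProduct_mulVec, ← mulVec_transpose, transpose_transpose, dotProduct_comm]
  rw [add_mulVec, dotProduct_add, h2] at h1
  rw [sub_mulVec, dotProduct_sub] at hx
  refine ((hs.R_psd t ht).dotProduct_mulVec_zero_iff x).1 ?_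
  rw [star_trivial]
  linarith

/-- Exhibits `algKernel` as the kernel of a stacked C¹ matrix, to which the smooth kernel projection
applies. -/
theorem mem_algKernel_iff {P : Matrix n n ℝ} {t : ℝ} (hker : IsKerProj P (s.E t)) (x : n → ℝ) :
    x ∈ s.algKernel t ↔ s.E t *ᵥ x = 0 ∧ (P * (s.J t - s.R t)) *ᵥ x = 0 := by
  refine and_congr_right fun _ => ⟨fun h => ?_, fun h y hy => ?_⟩
  · refine dotProduct_self_eq_zero.1 ?_
    rw [← mulVec_mulVec, dotProduct_mulVec, ← mulVec_transpose, hker.symm,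
      mulVec_mulVec (N := P), hker.idem]
    exact h _ (by rw [mulVec_mulVec, hker.mul_eq_zero, zero_mulVec])
  · rw [← hker.apply_of_mem y hy, dotProduct_comm, dotProduct_mulVec, ← mulVec_transpose, hker.symm, mulVec_mulVec, h,
      zero_dotProduct]

/-- A `C¹` curve in the kernel of `E` that `R` and the adjoint of `J` annihilate is a solution
of the homogeneous equation. -/
theorem IsPHDAE.E_mulVec_derivWithin (hs : s.IsPHDAE T) {w : ℝ → n → ℝ}
    (hw : ContDiffOn ℝ 1 w T) (hE : ∀ t ∈ T, s.E t *ᵥ w t = 0) (hR : ∀ t ∈ T, s.R t *ᵥ w t = 0)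
    (hJ : ∀ t ∈ T, (s.J t)ᵀ *ᵥ w t = 0) {t : ℝ} (ht : t ∈ T) :
    s.E t *ᵥ derivWithin w T t = s.A t *ᵥ w t := by
  have h : derivWithin (fun t => s.E t *ᵥ w t) T t = 0 := by
    rw [derivWithin_congr (f := fun _ => (0 : n → ℝ)) hE (hE t ht)]
    simp
  rw [derivWithin_mulVec hs.E_C1 hw ht, hs.skew_adjoint t ht] at h
  rw [eq_neg_of_add_eq_zero_right h, A]
  simp only [transpose_sub, transpose_mul, hs.E_symm t ht, add_mulVec, sub_mulVec,
    ← mulVec_mulVec, hE t ht, hR t ht, hJ t ht, mulVec_zero]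
  abel

end LTVSystem

/-! ### Orthogonal decompositions from flags of projections -/

/-- Mutually orthogonal symmetric projections that sum up to the identity. -/
structure IsOrthDecomp {k : ℕ} {n : Type} [Fintype n] [DecidableEq n]
    (P : Fin k → Matrix n n ℝ) : Prop where
  symm : ∀ i, (P i)ᵀ = P i
  idem : ∀ i, P i * P i = P i
  orth : ∀ i j, i ≠ j → P i * P j = 0
  sum_eq_one : ∑ i, P i = 1

section Flag

variable {n : Type} [Fintype n]

/-- A decreasing sequence of orthogonal projections. -/
structure IsProjFlag (Φ : ℕ → Matrix n n ℝ) : Prop where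
  symm : ∀ i, (Φ i)ᵀ = Φ i
  idem : ∀ i, Φ i * Φ i = Φ i
  mul_succ : ∀ i, Φ i * Φ (i + 1) = Φ (i + 1)

variable {Φ : ℕ → Matrix n n ℝ}

theorem IsProjFlag.mul_of_le (h : IsProjFlag Φ) {i j : ℕ} (hij : i ≤ j) : Φ i * Φ j = Φ j := by
  induction j, hij using Nat.le_induction with
  | base => exact h.idem i
  | succ j _ ih => rw [← h.mul_succ j, ← mul_assoc, ih]

theorem IsProjFlag.mul_of_ge (h : IsProjFlag Φ) {i j : ℕ} (hij : i ≤ j) : Φ j * Φ i = Φ j := by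
  have := congrArg Matrix.transpose (h.mul_of_le hij)
  rwa [transpose_mul, h.symm, h.symm] at this

theorem IsProjFlag.mul_diff_of_le (h : IsProjFlag Φ) {i j : ℕ} (hij : i ≤ j) :
    Φ i * (Φ j - Φ (j + 1)) = Φ j - Φ (j + 1) := by
  rw [mul_sub, h.mul_of_le hij, h.mul_of_le (by omega)]

theorem IsProjFlag.diff_mul_of_le (h : IsProjFlag Φ) {i j : ℕ} (hij : i ≤ j) :
    (Φ j - Φ (j + 1)) * Φ i = Φ j - Φ (j + 1) := by
  rw [sub_mul, h.mul_of_ge hij, h.mul_of_ge (by omega)]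

theorem IsProjFlag.mul_diff_of_lt (h : IsProjFlag Φ) {i j : ℕ} (hij : j < i) :
    Φ i * (Φ j - Φ (j + 1)) = 0 := by
  rw [mul_sub, h.mul_of_ge hij.le, h.mul_of_ge hij, sub_self]

theorem IsProjFlag.isOrthDecomp [DecidableEq n] (h : IsProjFlag Φ) (k : ℕ) (h0 : Φ 0 = 1)
    (hk : Φ k = 0) : IsOrthDecomp fun i : Fin k => Φ i - Φ (i + 1) where
  symm i := by rw [transpose_sub, h.symm, h.symm]
  idem i := by
    rw [sub_mul, h.mul_diff_of_le le_rfl, h.mul_diff_of_lt (Nat.lt_succ_self _), sub_zero]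
  orth i j hij := by
    rcases lt_or_gt_of_ne (Fin.val_ne_of_ne hij) with hlt | hgt
    · rw [sub_mul, h.mul_diff_of_le hlt.le, h.mul_diff_of_le hlt, sub_self]
    · rw [sub_mul, h.mul_diff_of_lt hgt, h.mul_diff_of_lt (by omega), sub_self]
  sum_eq_one := by
    rw [Fin.sum_univ_eq_sum_range (fun i => Φ i - Φ (i + 1)), Finset.sum_range_sub', h0, hk,
      sub_zero]

end Flag

/-- Orthogonal decompositions of the state and the input space that are adapted to the
coefficients `E`, `J`, `R`, `G` in the way the condensed form requires. -/
structure IsSplitting {n m : Type} [Fintype n] [DecidableEq n] [Fintype m] [DecidableEq m]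
    (E J R : Matrix n n ℝ) (G : Matrix n m ℝ) (P : Fin 6 → Matrix n n ℝ)
    (Q : Fin 3 → Matrix m m ℝ) : Prop where
  decompP : IsOrthDecomp P
  decompQ : IsOrthDecomp Q
  E_mul : ∀ i, 2 ≤ i → E * P i = 0
  R_mul : ∀ i, 3 ≤ i → R * P i = 0
  skew : ∀ i j, 2 ≤ i → 2 ≤ j → P i * (J + Jᵀ) * P j = 0
  mul_J_mul : ∀ i j, 2 ≤ i → 2 ≤ j → 3 ≤ i ∨ 3 ≤ j → P i * J * P j = 0
  four_J_one : P 4 * J * P 1 = 0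
  five_J : P 5 * J = 0
  three_G_zero : P 3 * G * Q 0 = 0
  four_G : ∀ j, j ≠ 2 → P 4 * G * Q j = 0
  five_G : ∀ j, j ≠ 2 → P 5 * G * Q j = 0
  inj_E : ∀ x, P 1 *ᵥ x = x → P 1 *ᵥ (E *ᵥ x) = 0 → x = 0
  inj_JR : ∀ x, P 2 *ᵥ x = x → P 2 *ᵥ ((J - R) *ᵥ x) = 0 → x = 0
  inj_J : ∀ x, P 0 *ᵥ x = x → P 4 *ᵥ (J *ᵥ x) = 0 → x = 0
  inj_JT : ∀ y, P 4 *ᵥ y = y → P 0 *ᵥ (Jᵀ *ᵥ y) = 0 → y = 0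
  inj_G3 : ∀ x, Q 1 *ᵥ x = x → P 3 *ᵥ (G *ᵥ x) = 0 → x = 0
  inj_G3T : ∀ y, P 3 *ᵥ y = y → Q 1 *ᵥ (Gᵀ *ᵥ y) = 0 → y = 0
  inj_G5 : ∀ x, Q 2 *ᵥ x = x → P 5 *ᵥ (G *ᵥ x) = 0 → x = 0
  inj_G5T : ∀ y, P 5 *ᵥ y = y → Q 2 *ᵥ (Gᵀ *ᵥ y) = 0 → y = 0

/-- The flag of subspaces of the state space belonging to the condensed form. -/
def stateFlag {n : Type} [DecidableEq n] (C PE PN A Z : Matrix n n ℝ) : ℕ → Matrix n n ℝ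
  | 0 => 1
  | 1 => C
  | 2 => PE
  | 3 => PN
  | 4 => Z + A
  | 5 => Z
  | _ => 0

/-- The flag of subspaces of the input space belonging to the condensed form. -/
def inputFlag {m : Type} [DecidableEq m] (C Q : Matrix m m ℝ) : ℕ → Matrix m m ℝ
  | 0 => 1
  | 1 => (1 - C) + (1 - Q)
  | 2 => 1 - Q
  | _ => 0

/-- The pointwise linear algebra. Ranges: `PE` is ker E, `PN` the space 𝒩, `Z` the second state
component, `Q` the kernel of ZG, `A` the vectors of 𝒩 ⊖ 𝒵 with Gᵀx in the range of GᵀZ, `C` the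
kernel of A(J - R), `D` that of (PN - Z - A)GQ. The state projections are 1 - C, C - PE, PE - PN, PN
- Z - A, A, Z; the input projections are Q D, 1 - D, 1 - Q. -/
theorem isSplitting_of_projections {n m : Type} [Fintype n] [DecidableEq n] [Fintype m]
    [DecidableEq m] {E J R : Matrix n n ℝ} {G : Matrix n m ℝ} {PE PN Z A C : Matrix n n ℝ}
    {Q D : Matrix m m ℝ} (hEpsd : E.PosSemidef)
    (hPE : IsKerProj PE E)
    (hPN : IsKerProj PN (fromRows E (PE * (J - R))))
    (hZs : Zᵀ = Z) (hZi : Z * Z = Z) (hNZ : PN * Z = Z)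
    (hZJ : Z * J = 0)
    (hZmax : ∀ x, PN *ᵥ x = x → (J - R)ᵀ *ᵥ x = 0 → Z *ᵥ x = x)
    (hZG : ∀ y, Gᵀ *ᵥ (Z *ᵥ y) = 0 → Z *ᵥ y = 0)
    (hskew : PE * (J + Jᵀ) * PE = 0) (hRs : Rᵀ = R) (hRN : R * PN = 0)
    (hQ : IsKerProj Q (Z * G))
    (hA : IsKerProj A (fromRows (1 - (PN - Z)) (Q * Gᵀ)))
    (hC : IsKerProj C (A * (J - R)))
    (hD : IsKerProj D ((PN - Z - A) * G * Q)) :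
    IsSplitting E J R G
      (fun i => stateFlag C PE PN A Z i - stateFlag C PE PN A Z (i + 1))
      (fun j => inputFlag D Q j - inputFlag D Q (j + 1)) := by
  have hrows : ∀ {l k : Type} {X : Matrix l n ℝ} {Y : Matrix k n ℝ} {B : Matrix n n ℝ},
      fromRows X Y * B = 0 → X * B = 0 ∧ Y * B = 0 := by
    intro l k X Y B h
    rw [fromRows_mul] at h
    exact ⟨by ext a b; exact congrFun (congrFun h (Sum.inl a)) b,
      by ext a b; exact congrFun (congrFun h (Sum.inr a)) b⟩
  have tr : ∀ {l k : Type} {X Y : Matrix l k ℝ}, X = Y → Xᵀ = Yᵀ := fun h => by rw [h]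
  have sandwich : ∀ X a S b Y : Matrix n n ℝ, X * a * S * (b * Y) = X * (a * S * b) * Y := by
    intros
    simp only [mul_assoc]
  have ap : ∀ {k l : Type} [Fintype k] {X Y : Matrix l k ℝ} {p : Matrix k k ℝ} {x : k → ℝ},
      p *ᵥ x = x → X * p = Y → X *ᵥ x = Y *ᵥ x := by
    intro k l _ X Y p x hx h
    rw [← h, ← mulVec_mulVec, hx]
  obtain ⟨hEN, hEDN⟩ := hrows hPN.mul_eq_zero
  obtain ⟨hA1, hA2⟩ := hrows hA.mul_eq_zero
  have hEPN : PE * PN = PN := hPE.mul_of_mul_eq_zero hEN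
  have hNPE : PN * PE = PN := by
    have := tr hEPN
    rwa [transpose_mul, hPE.symm, hPN.symm] at this
  have hZN : Z * PN = Z := by
    have := tr hNZ
    rwa [transpose_mul, hZs, hPN.symm] at this
  have hNR : PN * R = 0 := by
    have := tr hRN
    rwa [transpose_mul, hRs, hPN.symm, transpose_zero] at this
  have hEJN : PE * J * PN = 0 := by
    have : PE * J * PN = PE * (J - R) * PN + PE * (R * PN) := by noncomm_ring
    rw [this, hEDN, hRN, mul_zero, add_zero]
  have hNJTE : PN * Jᵀ * PE = 0 := by
    have := tr hEJN
    rwa [transpose_mul, transpose_mul, hPE.symm, hPN.symm, ← mul_assoc, transpose_zero] at this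
  -- The definition of 𝒩 gives only PE J PN = 0; skewness on ker E supplies the other side.
  have hNJE : PN * J * PE = 0 := by
    have : PN * J * PE = PN * (PE * (J + Jᵀ) * PE) - PN * Jᵀ * PE := by
      rw [← mul_assoc, ← mul_assoc, hNPE]; noncomm_ring
    rw [this, hskew, hNJTE, mul_zero, sub_zero]
  have hA1' : (PN - Z) * A = A := by
    rw [sub_mul, one_mul, sub_eq_zero] at hA1
    exact hA1.symm
  have hZA : Z * A = 0 := by
    rw [← hA1', ← mul_assoc, mul_sub, hZN, hZi, sub_self, zero_mul]
  have hAZ : A * Z = 0 := by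
    have := tr hZA
    rwa [transpose_mul, hZs, hA.symm, transpose_zero] at this
  have hNA : PN * A = A := by rw [← hA1', ← mul_assoc, mul_sub, hPN.idem, hNZ]
  have hAN : A * PN = A := by
    have := tr hNA
    rwa [transpose_mul, hPN.symm, hA.symm] at this
  have hAR : A * R = 0 := by rw [← hAN, mul_assoc, hNR, mul_zero]
  have hRA : R * A = 0 := by rw [← hNA, ← mul_assoc, hRN, zero_mul]
  have hAGQ : A * G * Q = 0 := by
    have := tr hA2
    rwa [transpose_mul, transpose_mul, transpose_transpose, hQ.symm, hA.symm, ← Matrix.mul_assoc,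
      transpose_zero] at this
  -- Since A lies in 𝒩, the product A J PE vanishes, so ker E lies in the range of C.
  have hCPE : C * PE = PE := hC.mul_of_mul_eq_zero (by
    rw [mul_sub, hAR, sub_zero, ← hAN, mul_assoc, mul_assoc, ← mul_assoc PN, hNJE, mul_zero])
  have hAJC : A * J * C = 0 := by
    have := hC.mul_eq_zero
    rwa [mul_sub, hAR, sub_zero] at this
  have hDQ : D * (1 - Q) = 1 - Q := hD.mul_of_mul_eq_zero (by
    rw [Matrix.mul_sub, Matrix.mul_one, Matrix.mul_assoc _ Q, hQ.idem, sub_self])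
  have hQD : (1 - Q) * D = 1 - Q := by
    have := tr hDQ
    rwa [transpose_mul, transpose_sub, transpose_one, hQ.symm, hD.symm] at this
  have hΦ : IsProjFlag (stateFlag C PE PN A Z) := by
    refine ⟨?_, ?_, ?_⟩
    · rintro (_ | _ | _ | _ | _ | _ | i) <;>
        simp [stateFlag, hC.symm, hPE.symm, hPN.symm, hZs, hA.symm]
    · rintro (_ | _ | _ | _ | _ | _ | i) <;>
        simp [stateFlag, hC.idem, hPE.idem, hPN.idem, hZi, hA.idem, mul_add, add_mul, hZA, hAZ]
    · rintro (_ | _ | _ | _ | _ | _ | i) <;>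
        simp [stateFlag, hCPE, hEPN, hNZ, hNA, hZi, mul_add, add_mul, hAZ]
  have hΨ : IsProjFlag (inputFlag D Q) := by
    have hd : (1 - D) * (1 - D) = 1 - D := by
      rw [sub_mul, mul_sub D, hD.idem]; simp
    have hq : (1 - Q) * (1 - Q) = 1 - Q := by
      rw [sub_mul, mul_sub Q, hQ.idem]; simp
    have hdq : (1 - D) * (1 - Q) = 0 := by rw [sub_mul, hDQ, one_mul, sub_self]
    have hqd : (1 - Q) * (1 - D) = 0 := by rw [mul_sub, hQD, mul_one, sub_self]
    refine ⟨?_, ?_, ?_⟩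
    · rintro (_ | _ | _ | i) <;> simp [inputFlag, hQ.symm, hD.symm]
    · rintro (_ | _ | _ | i) <;>
        simp only [inputFlag, add_mul, mul_add, hd, hq, hdq, hqd, mul_one, mul_zero, add_zero,
          zero_add]
    · rintro (_ | _ | _ | i) <;>
        simp only [inputFlag, add_mul, hq, hdq, one_mul, mul_zero, zero_add]
  have decP := hΦ.isOrthDecomp 6 rfl rfl
  have decQ := hΨ.isOrthDecomp 3 rfl rfl
  have h2 : ∀ i : Fin 6, 2 ≤ i → PE * (stateFlag C PE PN A Z i - stateFlag C PE PN A Z (i + 1)) =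
      stateFlag C PE PN A Z i - stateFlag C PE PN A Z (i + 1) := fun i hi =>
    hΦ.mul_diff_of_le (i := 2) hi
  have h3 : ∀ i : Fin 6, 3 ≤ i → PN * (stateFlag C PE PN A Z i - stateFlag C PE PN A Z (i + 1)) =
      stateFlag C PE PN A Z i - stateFlag C PE PN A Z (i + 1) := fun i hi =>
    hΦ.mul_diff_of_le (i := 3) hi
  have h2' : ∀ i : Fin 6, 2 ≤ i → (stateFlag C PE PN A Z i - stateFlag C PE PN A Z (i + 1)) * PE =
      stateFlag C PE PN A Z i - stateFlag C PE PN A Z (i + 1) := fun i hi =>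
    hΦ.diff_mul_of_le (i := 2) hi
  have h3' : ∀ i : Fin 6, 3 ≤ i → (stateFlag C PE PN A Z i - stateFlag C PE PN A Z (i + 1)) * PN =
      stateFlag C PE PN A Z i - stateFlag C PE PN A Z (i + 1) := fun i hi =>
    hΦ.diff_mul_of_le (i := 3) hi
  have hq' : ∀ j : Fin 3, j ≠ 2 →
      Q * (inputFlag D Q j - inputFlag D Q (j + 1)) =
        inputFlag D Q j - inputFlag D Q (j + 1) := by
    intro j hj
    have h := hΨ.mul_diff_of_lt (i := 2) (j := j) (by omega)
    simp only [inputFlag, sub_mul, one_mul] at h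
    exact (sub_eq_zero.1 h).symm
  have p0 : stateFlag C PE PN A Z (0 : Fin 6) - stateFlag C PE PN A Z ((0 : Fin 6) + 1) =
      1 - C := rfl
  have p1 : stateFlag C PE PN A Z (1 : Fin 6) - stateFlag C PE PN A Z ((1 : Fin 6) + 1) =
      C - PE := rfl
  have p2 : stateFlag C PE PN A Z (2 : Fin 6) - stateFlag C PE PN A Z ((2 : Fin 6) + 1) =
      PE - PN := rfl
  have p3 : stateFlag C PE PN A Z (3 : Fin 6) - stateFlag C PE PN A Z ((3 : Fin 6) + 1) =
      PN - Z - A := sub_add_eq_sub_sub _ _ _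
  have p4 : stateFlag C PE PN A Z (4 : Fin 6) - stateFlag C PE PN A Z ((4 : Fin 6) + 1) =
      A := add_sub_cancel_left _ _
  have p5 : stateFlag C PE PN A Z (5 : Fin 6) - stateFlag C PE PN A Z ((5 : Fin 6) + 1) =
      Z := sub_zero _
  have q0 : inputFlag D Q (0 : Fin 3) - inputFlag D Q ((0 : Fin 3) + 1) =
      Q + D - 1 := by
    change 1 - ((1 - D) + (1 - Q)) = _
    abel
  have q1 : inputFlag D Q (1 : Fin 3) - inputFlag D Q ((1 : Fin 3) + 1) =
      1 - D := add_sub_cancel_right _ _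
  have q2 : inputFlag D Q (2 : Fin 3) - inputFlag D Q ((2 : Fin 3) + 1) =
      1 - Q := sub_zero _
  refine
    { decompP := decP
      decompQ := decQ
      E_mul := fun i hi => by
        rw [← h2 i hi, ← mul_assoc, hPE.mul_eq_zero, zero_mul]
      R_mul := fun i hi => by
        rw [← h3 i hi, ← mul_assoc, hRN, zero_mul]
      skew := fun i j hi hj => by
        rw [← h2' i hi, ← h2 j hj, sandwich, hskew, mul_zero, zero_mul]
      mul_J_mul := fun i j hi hj hij => ?_
      four_J_one := ?_
      five_J := ?_
      three_G_zero := ?_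
      four_G := fun j hj => ?_
      five_G := fun j hj => ?_
      inj_E := fun x hx h => ?_
      inj_JR := fun x hx h => ?_
      inj_J := fun x hx h => ?_
      inj_JT := fun x hx h => ?_
      inj_G3 := fun x hx h => ?_
      inj_G3T := fun x hx h => ?_
      inj_G5 := fun x hx h => ?_
      inj_G5T := fun x hx h => ?_ } <;>
    simp only [p0, p1, p2, p3, p4, p5, q0, q1, q2] at *
  · rcases hij with hi' | hj'
    · rw [← h3' i hi', ← h2 j hj, sandwich, hNJE, mul_zero, zero_mul]
    · rw [← h2' i hi, ← h3 j hj', sandwich, hEJN, mul_zero, zero_mul]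
  · rw [mul_sub, hAJC, ← hAN, mul_assoc, mul_assoc, ← mul_assoc PN, hNJE]
    simp
  · exact hZJ
  · have hQD' : Q + D - 1 = Q * D := by
      rw [sub_mul, one_mul, sub_eq_sub_iff_add_eq_add] at hQD
      rw [sub_eq_iff_eq_add, add_comm Q, hQD, add_comm]
    rw [hQD', ← Matrix.mul_assoc, hD.mul_eq_zero]
  · rw [← hq' j hj, ← Matrix.mul_assoc, hAGQ, Matrix.zero_mul]
  · rw [← hq' j hj, ← Matrix.mul_assoc, hQ.mul_eq_zero, Matrix.zero_mul]
  · have hPEC : PE * C = PE := by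
      have := tr hCPE
      rwa [transpose_mul, hPE.symm, hC.symm] at this
    have hxE : x ⬝ᵥ (E *ᵥ x) = 0 := by
      conv_lhs => rw [← hx]
      rw [dotProduct_comm, dotProduct_mulVec, ← mulVec_transpose, transpose_sub, hPE.symm,
        hC.symm, hx, h, zero_dotProduct]
    -- Semidefiniteness of E turns a vanishing quadratic form into Ex = 0; x is also orthogonal to
    -- ker E.
    have hEx : E *ᵥ x = 0 := (hEpsd.dotProduct_mulVec_zero_iff x).1 hxE
    rw [← hPE.apply_of_mem x hEx, ap hx (Y := 0) (by rw [mul_sub, hPEC, hPE.idem, sub_self]),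
      zero_mulVec]
  · have hPEx : PE *ᵥ x = x := by
      rw [ap hx (Y := PE - PN) (by rw [mul_sub, hPE.idem, hEPN]), hx]
    -- The 𝒩-component of (J - R)x vanishes automatically, so the hypothesis gives PE(J - R)x = 0.
    -- Then x lies in 𝒩, to which it is orthogonal.
    have hNx : PN *ᵥ ((J - R) *ᵥ x) = 0 := by
      rw [← hPEx, mulVec_mulVec, mulVec_mulVec, mul_sub, hNR, sub_zero, hNJE, zero_mulVec]
    rw [sub_mulVec, hNx, sub_zero, mulVec_mulVec] at h
    rw [← hPN.apply_of_mem x ((fromRows_mulVec_eq_zero_iff _ _ _).2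
      ⟨(hPE.apply_eq_iff x).1 hPEx, h⟩),
      ap hx (Y := 0) (by rw [mul_sub, hNPE, hPN.idem, sub_self]), zero_mulVec]
  · rw [← hC.apply_of_mem x (by rw [mul_sub, hAR, sub_zero, ← mulVec_mulVec, h]),
      ap hx (Y := 0) (by rw [mul_sub, mul_one, hC.idem, sub_self]), zero_mulVec]
  -- The transpose of AJC = 0 upgrades the hypothesis to Jᵀx = 0. As Rx = 0 too, maximality puts x
  -- into 𝒵, although x is in 𝒜 ⊥ 𝒵.
  · have hCJ : C *ᵥ (Jᵀ *ᵥ x) = 0 := by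
      have := tr hAJC
      rw [transpose_mul, transpose_mul, hC.symm, hA.symm] at this
      rw [← hx, mulVec_mulVec, mulVec_mulVec, mul_assoc, this, transpose_zero, zero_mulVec]
    rw [sub_mulVec, one_mulVec, hCJ, sub_zero] at h
    have hRx : R *ᵥ x = 0 := by rw [ap hx hRA, zero_mulVec]
    have hNx : PN *ᵥ x = x := by rw [ap hx hNA, hx]
    rw [← hZmax x hNx (by rw [transpose_sub, hRs, sub_mulVec, h, hRx, sub_zero]), ap hx hZA,
      zero_mulVec]
  · have hQx : Q *ᵥ x = x := by
      rw [ap hx (Y := 1 - D) ?_, hx]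
      rw [sub_mul, one_mul, sub_eq_sub_iff_add_eq_add] at hQD
      rw [mul_sub, mul_one, sub_eq_sub_iff_add_eq_add, add_comm Q, hQD, add_comm]
    rw [← hD.apply_of_mem x (by rw [← mulVec_mulVec, hQx, ← mulVec_mulVec, h]),
      ap hx (Y := 0) (by rw [mul_sub, mul_one, hD.idem, sub_self]), zero_mulVec]
  · have hDv : D *ᵥ (Q *ᵥ (Gᵀ *ᵥ x)) = 0 := by
      have := tr hD.mul_eq_zero
      rw [transpose_mul, transpose_mul, transpose_mul, hQ.symm, hD.symm, transpose_sub,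
        transpose_sub, hPN.symm, hZs, hA.symm, transpose_zero] at this
      rw [← hx, mulVec_mulVec, mulVec_mulVec, mulVec_mulVec, Matrix.mul_assoc, Matrix.mul_assoc,
        this, zero_mulVec]
    -- QGᵀx is fixed by 1 - D, by the hypothesis, and killed by D. Its vanishing places x in 𝒜, to
    -- which x is orthogonal.
    have hv : Q *ᵥ (Gᵀ *ᵥ x) = 0 := by
      have h1 := congrArg (fun X => X *ᵥ (Gᵀ *ᵥ x)) hDQ
      simp only [mul_sub, mul_one, sub_mulVec, ← mulVec_mulVec, hDv, one_mulVec, sub_zero] at h1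
      rw [sub_mulVec, one_mulVec, h1, sub_sub_cancel] at h
      exact h
    rw [← hA.apply_of_mem x ((fromRows_mulVec_eq_zero_iff _ _ _).2 ⟨?_, ?_⟩),
      ap hx (Y := 0) (by rw [mul_sub, mul_sub, hAN, hAZ, hA.idem]; abel), zero_mulVec]
    · rw [ap hx (Y := 0) ?_, zero_mulVec]
      have h1 : (PN - Z) * (PN - Z) = PN - Z := by
        rw [mul_sub, sub_mul, sub_mul, hPN.idem, hZN, hNZ, hZi]; abel
      rw [sub_mul, one_mul, mul_sub (PN - Z), h1, hA1', sub_self]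
    · rw [← mulVec_mulVec, hv]
  · rw [← hQ.apply_of_mem x (by rw [← mulVec_mulVec, h]),
      ap hx (Y := 0) (by rw [mul_sub, mul_one, hQ.idem, sub_self]), zero_mulVec]
  · have hQx : Q *ᵥ (Gᵀ *ᵥ x) = 0 := by
      have := tr hQ.mul_eq_zero
      rw [transpose_mul, transpose_mul, hQ.symm, hZs, transpose_zero] at this
      rw [← hx, mulVec_mulVec, mulVec_mulVec, Matrix.mul_assoc, this, zero_mulVec]
    rw [sub_mulVec, one_mulVec, hQx, sub_zero] at h
    have := hZG x (by rw [hx, h])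
    rwa [hx] at this

/-! ### The role of regularity -/

namespace LTVSystem

/-- Regularity is assumed for the first block only, so the structure is needed there as well. -/
theorem IsPHDAE.of_augment {n₁ n₂ m : Type} [Fintype n₁] [Fintype n₂]
    {s : LTVSystem n₁ m} {G₂ : ℝ → Matrix n₂ m ℝ} {T : Set ℝ} (h : (s.augment G₂).IsPHDAE T) :
    s.IsPHDAE T where
  E_C1 i j := h.E_C1 (Sum.inl i) (Sum.inl j)
  J_cont := continuousOn_pi.2 fun i => continuousOn_pi.2 fun j =>
    continuousOn_pi.1 (continuousOn_pi.1 h.J_cont (Sum.inl i)) (Sum.inl j)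
  R_cont := continuousOn_pi.2 fun i => continuousOn_pi.2 fun j =>
    continuousOn_pi.1 (continuousOn_pi.1 h.R_cont (Sum.inl i)) (Sum.inl j)
  K_cont := continuousOn_pi.2 fun i => continuousOn_pi.2 fun j =>
    continuousOn_pi.1 (continuousOn_pi.1 h.K_cont (Sum.inl i)) (Sum.inl j)
  G_cont := continuousOn_pi.2 fun i => continuousOn_pi.1 h.G_cont (Sum.inl i)
  E_symm t ht := by
    ext i j
    exact congrFun (congrFun (h.E_symm t ht) (Sum.inl i)) (Sum.inl j)
  skew_adjoint t ht := by
    have := h.skew_adjoint t ht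
    simp only [augment, fromBlocks_multiply] at this
    ext i j
    have h1 := congrFun (congrFun this (Sum.inl i)) (Sum.inl j)
    simpa [matDeriv, -transpose_mul] using h1
  R_psd t ht := (h.R_psd t ht).submatrix Sum.inl

/-- In a regular port-Hamiltonian system, no nontrivial `C¹` curve in the kernel of `E` is
annihilated by `R` and by the adjoint of `J`. -/
theorem IsPHDAE.eq_zero_of_isRegular {n m : Type} [Fintype n] [Fintype m] {s : LTVSystem n m}
    {t₀ t₁ : ℝ} (ht : t₀ < t₁) (hs : s.IsPHDAE (Set.Icc t₀ t₁)) (hreg : s.IsRegular t₀ t₁)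
    {w : ℝ → n → ℝ} (hw : ContDiffOn ℝ 1 w (Set.Icc t₀ t₁))
    (hE : ∀ t ∈ Set.Icc t₀ t₁, s.E t *ᵥ w t = 0) (hR : ∀ t ∈ Set.Icc t₀ t₁, s.R t *ᵥ w t = 0)
    (hJ : ∀ t ∈ Set.Icc t₀ t₁, (s.J t)ᵀ *ᵥ w t = 0) : Set.EqOn w 0 (Set.Icc t₀ t₁) := by
  obtain ⟨k, hk⟩ := hreg
  have huniq := (hk 0 contDiffOn_const).2
  -- The hypotheses on w are pointwise and linear, so they survive a scalar factor; this one makes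
  -- the initial value zero. Uniqueness then gives w = 0 for t > t₀, and continuity covers t₀.
  have hv : ContDiffOn ℝ 1 (fun t => (t - t₀) • w t) (Set.Icc t₀ t₁) :=
    (contDiffOn_id.sub contDiffOn_const).smul hw
  have hvsol : s.IsStateSolution (Set.Icc t₀ t₁) (fun t => (t - t₀) • w t) 0 := by
    refine ⟨hv, fun t htT => ?_⟩
    rw [hs.E_mulVec_derivWithin hv (fun t h => by rw [mulVec_smul, hE t h, smul_zero])
      (fun t h => by rw [mulVec_smul, hR t h, smul_zero])
      (fun t h => by rw [mulVec_smul, hJ t h, smul_zero]) htT]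
    simp
  have h0sol : s.IsStateSolution (Set.Icc t₀ t₁) 0 0 := by
    refine ⟨contDiffOn_const, fun t _ => ?_⟩
    have : derivWithin (0 : ℝ → n → ℝ) (Set.Icc t₀ t₁) t = 0 := by
      rw [derivWithin_zero]; rfl
    rw [this]
    simp
  have hzero := huniq _ _ hvsol h0sol (by simp)
  have hIoc : Set.EqOn w 0 (Set.Ioc t₀ t₁) := fun t h => by
    have := hzero (Set.Ioc_subset_Icc_self h)
    exact (smul_eq_zero.1 this).resolve_left (sub_ne_zero.2 h.1.ne')
  exact hIoc.of_subset_closure hw.continuousOn continuousOn_const Set.Ioc_subset_Icc_self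
    (by rw [closure_Ioc ht.ne])

end LTVSystem

/-! ### Existence of a smooth splitting -/

theorem fromBlocks_zero_mulVec {n₁ n₂ : Type} [Fintype n₁] [Fintype n₂] (A : Matrix n₁ n₁ ℝ)
    (y : n₁ ⊕ n₂ → ℝ) : fromBlocks A 0 0 (0 : Matrix n₂ n₂ ℝ) *ᵥ y =
      Sum.elim (A *ᵥ (y ∘ Sum.inl)) 0 := by
  rw [fromBlocks_mulVec]
  simp

theorem mulVec_eq_zero_of_fromBlocks_zero {n₁ n₂ : Type} [Fintype n₁] [Fintype n₂]
    {A : Matrix n₁ n₁ ℝ} {y : n₁ ⊕ n₂ → ℝ}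
    (h : fromBlocks A 0 0 (0 : Matrix n₂ n₂ ℝ) *ᵥ y = 0) : A *ᵥ (y ∘ Sum.inl) = 0 := by
  rw [fromBlocks_zero_mulVec] at h
  ext i
  exact congrFun h (Sum.inl i)

theorem mulVec_transpose_eq_zero_of_rank {n m : Type} [Fintype n] [Fintype m]
    {G : Matrix n m ℝ} (h : G.rank = Fintype.card n) {x : n → ℝ} (hx : Gᵀ *ᵥ x = 0) : x = 0 := by
  have h1 := rank_add_finrank_ker Gᵀ
  rw [rank_transpose, h] at h1
  have h2 : LinearMap.ker (Gᵀ).mulVecLin = ⊥ := Submodule.finrank_eq_zero.1 (by omega)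
  have h3 : x ∈ LinearMap.ker (Gᵀ).mulVecLin := hx
  rwa [h2, Submodule.mem_bot] at h3

open LTVSystem in
-- What has to be shown is that every matrix whose kernel is used has constant rank. The four
-- assumed numbers cover ker E, 𝒩, its intersection with ker (J - R)ᵀ, and 𝒜; the other ranks are
-- forced by injectivity of transposes.
theorem exists_splitting {t₀ t₁ : ℝ} (ht : t₀ < t₁) {n₁ n₂ m : ℕ}
    {s₁ : LTVSystem (Fin n₁) (Fin m)} {G₂ : ℝ → Matrix (Fin n₂) (Fin m) ℝ}
    (hpH : (s₁.augment G₂).IsPHDAE (Set.Icc t₀ t₁))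
    (hH : ∀ t ∈ Set.Icc t₀ t₁, ∀ z, 0 ≤ (s₁.augment G₂).hamiltonian t z)
    (hJ : MatC1On s₁.J (Set.Icc t₀ t₁)) (hR : MatC1On s₁.R (Set.Icc t₀ t₁))
    (hG₁ : MatC1On s₁.G (Set.Icc t₀ t₁)) (hG₂ : MatC1On G₂ (Set.Icc t₀ t₁))
    (hreg : s₁.IsRegular t₀ t₁)
    (hfull : ∀ t ∈ Set.Icc t₀ t₁, (G₂ t).rank = n₂)
    (hrank : (s₁.augment G₂).HasConstantRanks (Set.Icc t₀ t₁)) :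
    ∃ (P : Fin 6 → ℝ → Matrix (Fin n₁ ⊕ Fin n₂) (Fin n₁ ⊕ Fin n₂) ℝ)
      (Q : Fin 3 → ℝ → Matrix (Fin m) (Fin m) ℝ),
      (∀ i, MatC1On (P i) (Set.Icc t₀ t₁)) ∧ (∀ j, MatC1On (Q j) (Set.Icc t₀ t₁)) ∧
      ∀ t ∈ Set.Icc t₀ t₁, IsSplitting ((s₁.augment G₂).E t) ((s₁.augment G₂).J t)
        ((s₁.augment G₂).R t) ((s₁.augment G₂).G t) (fun i => P i t) (fun j => Q j t) := by
  obtain ⟨r₁, r₂, r₃, r₄, hr⟩ := hrank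
  have hs₁ := hpH.of_augment
  set S := s₁.augment G₂ with hS
  set T := Set.Icc t₀ t₁
  have hSE : MatC1On S.E T := hpH.E_C1
  have hSJ : MatC1On S.J T := hJ.fromBlocks (.const 0 T) (.const 0 T) (.const 0 T)
  have hSR : MatC1On S.R T := hR.fromBlocks (.const 0 T) (.const 0 T) (.const 0 T)
  have hSG : MatC1On S.G T := hG₁.fromRows hG₂
  have hSD : MatC1On (fun t => S.J t - S.R t) T := hSJ.sub hSR
  have hEpsd : ∀ t ∈ T, (S.E t).PosSemidef := by
    intro t ht
    refine PosSemidef.of_dotProduct_mulVec_nonneg ?_ fun x => ?_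
    · rw [IsHermitian, conjTranspose_eq_transpose_of_trivial, hpH.E_symm t ht]
    · have := hH t ht x
      rw [hamiltonian] at this
      rw [star_trivial]
      linarith
  have hRs : ∀ t ∈ T, (S.R t)ᵀ = S.R t := fun t ht => by
    have := (hpH.R_psd t ht).1
    rwa [IsHermitian, conjTranspose_eq_transpose_of_trivial] at this
  -- kernel of `E`
  obtain ⟨PE, hPE1, hPE⟩ := hSE.exists_isKerProj fun t ht => (hr t ht).1
  -- kernel of the compression of `J - R`
  have hkerN : ∀ t ∈ T, LinearMap.ker (fromRows (S.E t) (PE t * (S.J t - S.R t))).mulVecLin =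
      S.algKernel t := by
    intro t ht
    ext x
    rw [LinearMap.mem_ker, mulVecLin_apply, fromRows_mulVec_eq_zero_iff,
      mem_algKernel_iff (hPE t ht)]
  obtain ⟨PN, hPN1, hPN⟩ := (hSE.fromRows (hPE1.mul hSD)).exists_isKerProj_of_finrank
    fun t ht => by rw [hkerN t ht]; exact (hr t ht).2.1
  have hNmem : ∀ t ∈ T, ∀ x, x ∈ S.algKernel t ↔ PN t *ᵥ x = x := by
    intro t ht x
    rw [(hPN t ht).apply_eq_iff, ← hkerN t ht, LinearMap.mem_ker, mulVecLin_apply]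
  have hRmem : ∀ t ∈ T, ∀ x ∈ S.algKernel t, S.R t *ᵥ x = 0 := fun t ht x hx =>
    hpH.R_mulVec_eq_zero hPE1 hPE ht hx.1 (hx.2 x hx.1)
  have hRN : ∀ t ∈ T, S.R t * PN t = 0 := by
    intro t ht
    rw [ext_iff_mulVec]
    intro x
    rw [zero_mulVec, ← mulVec_mulVec]
    refine hRmem t ht _ ((hNmem t ht _).2 ?_)
    rw [mulVec_mulVec, (hPN t ht).idem]
  -- the common kernel with the adjoint
  have hker_compl : ∀ t ∈ T, ∀ x, (1 - PN t) *ᵥ x = 0 ↔ x ∈ S.algKernel t := by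
    intro t ht x
    rw [hNmem t ht, sub_mulVec, one_mulVec, sub_eq_zero, eq_comm]
  obtain ⟨PZ, hPZ1, hPZ⟩ := (((MatC1On.const 1 T).sub hPN1).fromRows
    hSD.transpose).exists_isKerProj_of_finrank (k := r₂ - r₃) fun t ht => by
      have h1 := finrank_inf_ker_add_finrank_map (S.algKernel t) ((S.J t - S.R t)ᵀ).mulVecLin
      rw [(hr t ht).2.1, (hr t ht).2.2.1] at h1
      have h2 : LinearMap.ker (fromRows (1 - PN t) (S.J t - S.R t)ᵀ).mulVecLin =
          S.algKernel t ⊓ LinearMap.ker ((S.J t - S.R t)ᵀ).mulVecLin := by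
        ext x
        rw [LinearMap.mem_ker, mulVecLin_apply, fromRows_mulVec_eq_zero_iff, hker_compl t ht]
        rfl
      rw [h2]
      omega
  have hZ_inl : ∀ t ∈ T, ∀ x, PN t *ᵥ x = x → (S.J t - S.R t)ᵀ *ᵥ x = 0 →
      ∀ i, x (Sum.inl i) = 0 := by
    intro t ht' x hNx hDx i
    have hmem : ∀ r ∈ T, PZ r *ᵥ x ∈ S.algKernel r ∧ (S.J r - S.R r)ᵀ *ᵥ (PZ r *ᵥ x) = 0 := by
      intro r hr'
      have h := ((hPZ r hr').apply_eq_iff (PZ r *ᵥ x)).1 (by rw [mulVec_mulVec, (hPZ r hr').idem])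
      rw [fromRows_mulVec_eq_zero_iff, hker_compl r hr'] at h
      exact h
    -- The curve r ↦ PZ(r) x stays in the common kernel and passes through x at r = t; its first
    -- component is annihilated by E₁, R₁ and J₁ᵀ.
    have hcurve := hs₁.eq_zero_of_isRegular ht hreg (w := fun r => (PZ r *ᵥ x) ∘ Sum.inl)
      (contDiffOn_pi.2 fun i => contDiffOn_pi.1 (hPZ1.mulVec contDiffOn_const) (Sum.inl i))
      (fun r hr' => mulVec_eq_zero_of_fromBlocks_zero (hmem r hr').1.1)
      (fun r hr' => mulVec_eq_zero_of_fromBlocks_zero (hRmem r hr' _ (hmem r hr').1))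
      (fun r hr' => by
        have h := (hmem r hr').2
        rw [transpose_sub, hRs r hr', sub_mulVec, hRmem r hr' _ (hmem r hr').1, sub_zero] at h
        refine mulVec_eq_zero_of_fromBlocks_zero (n₂ := Fin n₂) ?_
        simpa [S, augment, fromBlocks_transpose] using h)
    have hx : PZ t *ᵥ x = x := (hPZ t ht').apply_of_mem x
      ((fromRows_mulVec_eq_zero_iff _ _ _).2
        ⟨(hker_compl t ht' x).2 ((hNmem t ht' x).2 hNx), hDx⟩)
    have := congrFun (hcurve ht') i
    simpa [hx] using this
  let Z : Matrix (Fin n₁ ⊕ Fin n₂) (Fin n₁ ⊕ Fin n₂) ℝ := fromBlocks 0 0 0 1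
  have hZs : Zᵀ = Z := by simp [Z, fromBlocks_transpose]
  have hZi : Z * Z = Z := by simp [Z, fromBlocks_multiply]
  have hZ_apply : ∀ x, Z *ᵥ x = Sum.elim (0 : Fin n₁ → ℝ) (x ∘ Sum.inr) := fun x => by
    simp [Z, fromBlocks_mulVec]
  have hZJ : ∀ t, Z * S.J t = 0 := fun t => by simp [Z, S, augment, fromBlocks_multiply]
  have hNZ : ∀ t ∈ T, PN t * Z = Z := fun t ht => (hPN t ht).mul_of_mul_eq_zero (by
    rw [fromRows_mul, mul_assoc, sub_mul]
    have h1 : S.E t * Z = 0 := by simp [Z, S, augment, fromBlocks_multiply]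
    have h2 : S.J t * Z = 0 := by simp [Z, S, augment, fromBlocks_multiply]
    have h3 : S.R t * Z = 0 := by simp [Z, S, augment, fromBlocks_multiply]
    rw [h1, h2, h3, sub_zero, mul_zero, fromRows_zero])
  have hZN : ∀ t ∈ T, Z * PN t = Z := fun t ht => by
    have := congrArg Matrix.transpose (hNZ t ht)
    rwa [transpose_mul, hZs, (hPN t ht).symm] at this
  have hZmax : ∀ t ∈ T, ∀ x, PN t *ᵥ x = x → (S.J t - S.R t)ᵀ *ᵥ x = 0 → Z *ᵥ x = x := by
    intro t ht x h1 h2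
    rw [hZ_apply]
    ext (i | i)
    · exact (hZ_inl t ht x h1 h2 i).symm
    · rfl
  have hZG : ∀ t ∈ T, ∀ y, (S.G t)ᵀ *ᵥ (Z *ᵥ y) = 0 → Z *ᵥ y = 0 := by
    intro t ht y h
    rw [hZ_apply] at h ⊢
    have h1 : (G₂ t)ᵀ *ᵥ (y ∘ Sum.inr) = 0 := by
      simpa [S, augment, transpose_fromRows, fromCols_mulVec] using h
    rw [mulVec_transpose_eq_zero_of_rank (by rw [hfull t ht, Fintype.card_fin]) h1]
    ext (i | i) <;> rfl
  -- decomposition of the input space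
  obtain ⟨Q, hQ1, hQ⟩ := ((MatC1On.const Z T).mul hSG).exists_isKerProj (r := Z.rank)
    fun t ht => by
      rw [← rank_transpose, transpose_mul, hZs]
      refine rank_eq_of_mulVec_eq_zero_iff fun x => ⟨fun h => hZG t ht x ?_, fun h => ?_⟩
      · rwa [mulVec_mulVec]
      · rw [← mulVec_mulVec, h, mulVec_zero]
  obtain ⟨A, hA1, hA⟩ := ((((MatC1On.const 1 T).sub (hPN1.sub (.const Z T))).fromRows
    (hQ1.mul hSG.transpose))).exists_isKerProj_of_finrank (k := r₂ - r₄) fun t ht => by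
      have hN := (hPN t ht).idem
      -- The projection 1 - Z maps 𝒩 ∩ ker Gᵀ onto 𝒜, injectively because Gᵀ is injective on 𝒵.
      -- Hence dim 𝒜 = r₂ - r₄.
      have hker_map : LinearMap.ker (fromRows (1 - (PN t - Z)) (Q t * (S.G t)ᵀ)).mulVecLin =
          (S.algKernel t ⊓ LinearMap.ker ((S.G t)ᵀ).mulVecLin).map (1 - Z).mulVecLin := by
        ext y
        rw [LinearMap.mem_ker, mulVecLin_apply, fromRows_mulVec_eq_zero_iff, sub_mulVec,
          one_mulVec, sub_eq_zero, ← mulVec_mulVec]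
        constructor
        · rintro ⟨h1, h2⟩
          have hZy : Z *ᵥ y = 0 := by
            rw [h1, mulVec_mulVec, mul_sub, hZN t ht, hZi, sub_self, zero_mulVec]
          have hNy : PN t *ᵥ y = y := by
            conv_lhs => rw [h1, mulVec_mulVec, mul_sub, hN, hNZ t ht, ← h1]
          -- QGᵀy = 0 means Gᵀy = GᵀZw for some w, so y - Zw is a preimage of y in ker Gᵀ.
          obtain ⟨w, hw⟩ := (hQ t ht).exists_transpose_mulVec_eq h2
          rw [transpose_mul, hZs, ← mulVec_mulVec] at hw
          refine ⟨y - Z *ᵥ w, ⟨(hNmem t ht _).2 ?_, ?_⟩, ?_⟩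
          · rw [mulVec_sub, hNy, mulVec_mulVec, hNZ t ht]
          · rw [SetLike.mem_coe, LinearMap.mem_ker, mulVecLin_apply, mulVec_sub, hw, sub_self]
          · rw [mulVecLin_apply, sub_mulVec, one_mulVec, mulVec_sub, hZy, mulVec_mulVec, hZi]
            abel
        · rintro ⟨x, ⟨hx1, hx2⟩, rfl⟩
          have hNx := (hNmem t ht x).1 hx1
          rw [SetLike.mem_coe, LinearMap.mem_ker, mulVecLin_apply] at hx2
          have hQGZ := congrArg Matrix.transpose (hQ t ht).mul_eq_zero
          rw [transpose_mul, transpose_mul, (hQ t ht).symm, hZs, transpose_zero] at hQGZ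
          rw [mulVecLin_apply, sub_mulVec, one_mulVec]
          constructor
          · simp only [sub_mulVec, mulVec_sub, hNx, mulVec_mulVec, sub_mul, hNZ t ht, hZi, sub_self,
              zero_mulVec, sub_zero]
          · rw [mulVec_sub, hx2, zero_sub, mulVec_neg, mulVec_mulVec, mulVec_mulVec,
              Matrix.mul_assoc, hQGZ, zero_mulVec, neg_zero]
      have h1 := finrank_inf_ker_add_finrank_map (S.algKernel t) ((S.G t)ᵀ).mulVecLin
      have h2 := finrank_inf_ker_add_finrank_map
        (S.algKernel t ⊓ LinearMap.ker ((S.G t)ᵀ).mulVecLin) (1 - Z).mulVecLin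
      have h3 : S.algKernel t ⊓ LinearMap.ker ((S.G t)ᵀ).mulVecLin ⊓
          LinearMap.ker (1 - Z).mulVecLin = ⊥ := by
        rw [eq_bot_iff]
        rintro x ⟨⟨-, hx2⟩, hx3⟩
        rw [SetLike.mem_coe, LinearMap.mem_ker, mulVecLin_apply] at hx2 hx3
        rw [sub_mulVec, one_mulVec, sub_eq_zero] at hx3
        rw [hx3] at hx2
        rw [Submodule.mem_bot, hx3]
        exact hZG t ht x hx2
      rw [(hr t ht).2.1, (hr t ht).2.2.2] at h1
      rw [h3, finrank_bot] at h2
      rw [hker_map]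
      omega
  have hA_facts : ∀ t ∈ T, (PN t - Z) * A t = A t ∧ Z * A t = 0 ∧ PN t * A t = A t := by
    intro t ht
    have h1 : (PN t - Z) * A t = A t := by
      have := (hA t ht).mul_eq_zero
      rw [fromRows_mul, ← fromRows_zero, fromRows_inj.eq_iff, sub_mul, one_mul, sub_eq_zero] at this
      exact this.1.symm
    refine ⟨h1, ?_, ?_⟩
    · rw [← h1, ← mul_assoc, mul_sub, hZN t ht, hZi, sub_self, zero_mul]
    · rw [← h1, ← mul_assoc, mul_sub, (hPN t ht).idem, hNZ t ht]
  have hNZi : ∀ t ∈ T, (PN t - Z) * (PN t - Z) = PN t - Z := fun t ht => by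
    rw [mul_sub, sub_mul, sub_mul, (hPN t ht).idem, hZN t ht, hNZ t ht, hZi]
    abel
  have hXs : ∀ t ∈ T, (PN t - Z - A t)ᵀ = PN t - Z - A t := fun t ht => by
    rw [transpose_sub, transpose_sub, (hPN t ht).symm, hZs, (hA t ht).symm]
  have hAX : ∀ t ∈ T, A t * (PN t - Z - A t) = 0 := fun t ht => by
    have h := congrArg Matrix.transpose (hA_facts t ht).1
    rw [transpose_mul, transpose_sub, (hPN t ht).symm, hZs, (hA t ht).symm] at h
    rw [mul_sub, h, (hA t ht).idem, sub_self]
  obtain ⟨rA, hrA⟩ := hA1.exists_rank_eq ht (fun t ht => (hA t ht).symm)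
    (fun t ht => (hA t ht).idem)
  -- (J - R)ᵀ is injective on 𝒜, because a kernel vector there would lie in 𝒵; so A(J - R) has the
  -- rank of A.
  obtain ⟨C, hC1, hC⟩ := (hA1.mul hSD).exists_isKerProj (r := rA) fun t ht => by
    rw [← rank_transpose, transpose_mul, (hA t ht).symm, ← hrA t ht]
    refine rank_eq_of_mulVec_eq_zero_iff fun x => ⟨fun h => ?_, fun h => ?_⟩
    · obtain ⟨-, h2, h3⟩ := hA_facts t ht
      rw [← mulVec_mulVec] at h
      have := hZmax t ht _ (by rw [mulVec_mulVec, h3]) h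
      rwa [mulVec_mulVec, h2, zero_mulVec, eq_comm] at this
    · rw [← mulVec_mulVec, h, mulVec_zero]
  obtain ⟨rX, hrX⟩ := ((hPN1.sub (.const Z T)).sub hA1).exists_rank_eq ht
    hXs fun t ht => by
      rw [sub_mul, hAX t ht, sub_zero, mul_sub, hNZi t ht, (hA_facts t ht).1]
  -- QGᵀ is injective on 𝒩 ⊖ 𝒵 ⊖ 𝒜, since its kernel in 𝒩 ⊖ 𝒵 is 𝒜.
  obtain ⟨D, hD1, hD⟩ := ((((hPN1.sub (.const Z T)).sub hA1).mul hSG).mul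
    hQ1).exists_isKerProj (r := rX) fun t ht => by
      rw [← rank_transpose, transpose_mul, transpose_mul, (hQ t ht).symm, hXs t ht,
        ← hrX t ht, ← Matrix.mul_assoc]
      refine rank_eq_of_mulVec_eq_zero_iff fun x => ⟨fun h => ?_, fun h => ?_⟩
      · obtain ⟨h1, h2, h3⟩ := hA_facts t ht
        rw [← mulVec_mulVec] at h
        have hAy := (hA t ht).apply_of_mem ((PN t - Z - A t) *ᵥ x)
          ((fromRows_mulVec_eq_zero_iff _ _ _).2 ⟨?_, h⟩)
        · rw [← hAy, mulVec_mulVec, hAX t ht, zero_mulVec]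
        · rw [mulVec_mulVec, sub_mul, one_mul, mul_sub (PN t - Z), hNZi t ht, h1, sub_self,
            zero_mulVec]
      · rw [← mulVec_mulVec, h, mulVec_zero]
  have hΦ : ∀ i, MatC1On (fun t => stateFlag (C t) (PE t) (PN t) (A t) Z i) T := by
    rintro (_ | _ | _ | _ | _ | _ | i)
    exacts [.const 1 T, hC1, hPE1, hPN1, (MatC1On.const Z T).add hA1, .const Z T, .const 0 T]
  have hΨ : ∀ i, MatC1On (fun t => inputFlag (D t) (Q t) i) T := by
    have hd := (MatC1On.const 1 T).sub hD1
    have hq := (MatC1On.const 1 T).sub hQ1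
    rintro (_ | _ | _ | i)
    exacts [.const 1 T, hd.add hq, hq, .const 0 T]
  refine ⟨fun i t => _, fun j t => _, fun i => (hΦ i).sub (hΦ (i + 1)),
    fun j => (hΨ j).sub (hΨ (j + 1)), fun t ht => ?_⟩
  exact isSplitting_of_projections (hEpsd t ht) (hPE t ht) (hPN t ht) hZs hZi (hNZ t ht) (hZJ t)
    (hZmax t ht) (hZG t ht) (hpH.ker_compression_skew hPE1 hPE ht) (hRs t ht) (hRN t ht)
    (hQ t ht) (hA t ht) (hC t ht) (hD t ht)

/-! ### Block matrices and frames -/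

section Blocks

theorem HasPattern.apply {k l : ℕ} {d : Fin k → ℕ} {e : Fin l → ℕ}
    {M : Matrix (BlockIdx d) (BlockIdx e) ℝ} {pat : Matrix (Fin k) (Fin l) ℕ}
    (h : HasPattern M pat) {x : BlockIdx d} {y : BlockIdx e} (hxy : pat x.1 y.1 = 0) :
    M x y = 0 :=
  congrFun (congrFun (h x.1 y.1 hxy) x.2) y.2

theorem mulVec_apply_eq_sum_blk {k l : ℕ} {d : Fin k → ℕ} {e : Fin l → ℕ}
    (M : Matrix (BlockIdx d) (BlockIdx e) ℝ) (x : BlockIdx e → ℝ) (i : Fin k) (a : Fin (d i)) :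
    (M *ᵥ x) ⟨i, a⟩ = ∑ j, (blk M i j *ᵥ fun b => x ⟨j, b⟩) a := by
  simp only [Matrix.mulVec, dotProduct, Fintype.sum_sigma]
  rfl

theorem IsInvertibleMatrix.eq_zero_of_mulVec {m n : Type} [Fintype m] [Fintype n] [DecidableEq m]
    [DecidableEq n] {M : Matrix m n ℝ} (h : IsInvertibleMatrix M) {x : n → ℝ}
    (hx : M *ᵥ x = 0) : x = 0 := by
  obtain ⟨B, -, hB⟩ := h
  rw [← one_mulVec x, ← hB, ← mulVec_mulVec, hx, mulVec_zero]

theorem IsInvertibleMatrix.neg_transpose {m n : Type} [Fintype m] [Fintype n] [DecidableEq m]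
    [DecidableEq n] {M : Matrix m n ℝ} (h : IsInvertibleMatrix M) :
    IsInvertibleMatrix (-Mᵀ) := by
  obtain ⟨B, hB1, hB2⟩ := h
  refine ⟨-Bᵀ, ?_, ?_⟩
  · rw [Matrix.neg_mul, Matrix.mul_neg, neg_neg, ← transpose_mul, hB2, transpose_one]
  · rw [Matrix.neg_mul, Matrix.mul_neg, neg_neg, ← transpose_mul, hB1, transpose_one]

theorem isInvertibleMatrix_of_injective {n : Type} [Fintype n] [DecidableEq n]
    {M : Matrix n n ℝ} (h : ∀ x, M *ᵥ x = 0 → x = 0) : IsInvertibleMatrix M := by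
  have hu : IsUnit M := by
    rw [← mulVec_injective_iff_isUnit]
    exact (injective_iff_map_eq_zero M.mulVecLin).2 h
  obtain ⟨u, rfl⟩ := hu
  exact ⟨(u⁻¹ : (Matrix n n ℝ)ˣ), u.mul_inv, u.inv_mul⟩

/-- Injectivity of M makes MᵀM invertible and gives a left inverse N. Then MN - 1 is annihilated by
Mᵀ, hence zero. Needed for blocks whose row and column sizes are not known to agree beforehand. -/
theorem isInvertibleMatrix_of_injective_transpose {m n : Type} [Fintype m] [Fintype n]
    [DecidableEq m] [DecidableEq n] {M : Matrix m n ℝ} (h : ∀ x, M *ᵥ x = 0 → x = 0)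
    (h' : ∀ y, Mᵀ *ᵥ y = 0 → y = 0) : IsInvertibleMatrix M := by
  obtain ⟨B, hB1, hB2⟩ := isInvertibleMatrix_of_injective (M := Mᵀ * M) fun x hx =>
    h x ((Matrix.transpose_mul_self_mulVec_eq_zero_iff M x).1 hx)
  refine ⟨B * Mᵀ, ?_, by rw [Matrix.mul_assoc, hB2]⟩
  rw [← sub_eq_zero]
  ext i j
  refine congrFun (h' (fun k => (M * (B * Mᵀ) - 1 : Matrix m m ℝ) k j) ?_) i
  have h0 : Mᵀ * (M * (B * Mᵀ) - 1) = 0 := by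
    rw [Matrix.mul_sub, ← Matrix.mul_assoc, ← Matrix.mul_assoc, hB1, Matrix.one_mul,
      Matrix.mul_one, sub_self]
  ext k
  exact congrFun (congrFun h0 k) j

variable {n m : Type} [Fintype n] [Fintype m]

/-- The matrix with the given block columns. -/
def blockCols {k : ℕ} {d : Fin k → ℕ} (F : ∀ i, Matrix n (Fin (d i)) ℝ) :
    Matrix n (BlockIdx d) ℝ :=
  Matrix.of fun a x => F x.1 a x.2

/-- Orthonormal bases of the ranges of an orthogonal decomposition. -/
structure IsFrameFamily [DecidableEq n] {k : ℕ} {d : Fin k → ℕ} (F : ∀ i, Matrix n (Fin (d i)) ℝ)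
    (P : Fin k → Matrix n n ℝ) : Prop where
  decomp : IsOrthDecomp P
  transpose_mul_self : ∀ i, (F i)ᵀ * F i = 1
  mul_transpose : ∀ i, F i * (F i)ᵀ = P i

variable [DecidableEq n] [DecidableEq m] {k l : ℕ} {d : Fin k → ℕ} {e : Fin l → ℕ}
  {F : ∀ i, Matrix n (Fin (d i)) ℝ} {P : Fin k → Matrix n n ℝ}
  {H : ∀ i, Matrix m (Fin (e i)) ℝ} {Q : Fin l → Matrix m m ℝ}

theorem IsFrameFamily.proj_mul (h : IsFrameFamily F P) (i : Fin k) : P i * F i = F i := by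
  rw [← h.mul_transpose, Matrix.mul_assoc, h.transpose_mul_self, Matrix.mul_one]

theorem IsFrameFamily.transpose_mul_proj (h : IsFrameFamily F P) (i : Fin k) :
    (F i)ᵀ * P i = (F i)ᵀ := by
  rw [← h.mul_transpose, ← Matrix.mul_assoc, h.transpose_mul_self, Matrix.one_mul]

theorem IsFrameFamily.block_eq_zero (h : IsFrameFamily F P) (h' : IsFrameFamily H Q)
    {M : Matrix n m ℝ} {i : Fin k} {j : Fin l} (hM : P i * M * Q j = 0) :
    (F i)ᵀ * M * H j = 0 := by
  have : (F i)ᵀ * M * H j = (F i)ᵀ * (P i * M * Q j) * H j := by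
    rw [← Matrix.mul_assoc, ← Matrix.mul_assoc, h.transpose_mul_proj, Matrix.mul_assoc _ (Q j),
      h'.proj_mul]
  rw [this, hM, Matrix.mul_zero, Matrix.zero_mul]

theorem IsFrameFamily.blockCols_orthogonal (h : IsFrameFamily F P) :
    (blockCols F)ᵀ * blockCols F = 1 ∧ blockCols F * (blockCols F)ᵀ = 1 := by
  constructor
  · ext ⟨i, a⟩ ⟨j, b⟩
    rw [show ((blockCols F)ᵀ * blockCols F) ⟨i, a⟩ ⟨j, b⟩ = ((F i)ᵀ * F j) a b from rfl]
    by_cases hij : i = j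
    · subst hij
      rw [h.transpose_mul_self, Matrix.one_apply, Matrix.one_apply]
      simp
    · have h0 := h.block_eq_zero h (M := 1) (i := i) (j := j) (by
        rw [mul_one, h.decomp.orth i j hij])
      rw [Matrix.mul_one] at h0
      rw [h0, Matrix.one_apply_ne (by simp [hij]), Matrix.zero_apply]
  · rw [← h.decomp.sum_eq_one]
    ext a b
    rw [Matrix.sum_apply, Matrix.mul_apply, Fintype.sum_sigma]
    exact Finset.sum_congr rfl fun i _ => by rw [← h.mul_transpose]; rfl

theorem IsFrameFamily.eq_zero_of_block_mulVec (h : IsFrameFamily F P) (h' : IsFrameFamily H Q)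
    {M : Matrix n m ℝ} {i : Fin k} {j : Fin l}
    (hM : ∀ x, Q j *ᵥ x = x → P i *ᵥ (M *ᵥ x) = 0 → x = 0) {x : Fin (e j) → ℝ}
    (hx : ((F i)ᵀ * M * H j) *ᵥ x = 0) : x = 0 := by
  have h0 := hM (H j *ᵥ x) (by rw [mulVec_mulVec, h'.proj_mul]) (by
    rw [← h.mul_transpose, ← mulVec_mulVec, mulVec_mulVec x M, mulVec_mulVec x (F i)ᵀ,
      ← Matrix.mul_assoc, hx, mulVec_zero])
  rw [← one_mulVec x, ← h'.transpose_mul_self, ← mulVec_mulVec, h0, mulVec_zero]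

theorem IsFrameFamily.isInvertibleMatrix_block (h : IsFrameFamily F P) (h' : IsFrameFamily H Q)
    {M : Matrix n m ℝ} {i : Fin k} {j : Fin l}
    (hM : ∀ x, Q j *ᵥ x = x → P i *ᵥ (M *ᵥ x) = 0 → x = 0)
    (hM' : ∀ y, P i *ᵥ y = y → Q j *ᵥ (Mᵀ *ᵥ y) = 0 → y = 0) :
    IsInvertibleMatrix ((F i)ᵀ * M * H j) := by
  refine isInvertibleMatrix_of_injective_transpose
    (fun x hx => h.eq_zero_of_block_mulVec h' hM hx)
    (fun y hy => h'.eq_zero_of_block_mulVec h hM' ?_)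
  rwa [transpose_mul, transpose_mul, transpose_transpose, ← Matrix.mul_assoc] at hy

end Blocks

/-! ### Transformation of solutions -/

/-- Congruent systems have the same solutions up to the change of variables. -/
theorem IsCongruent.isSolution_iff {n m n' m' : Type} [Fintype n] [Fintype m] [Fintype n']
    [Fintype m'] [DecidableEq n] [DecidableEq m] [DecidableEq n'] [DecidableEq m']
    {s : LTVSystem n m} {c : LTVSystem n' m'} {V : ℝ → Matrix n n' ℝ}
    {U : ℝ → Matrix m m' ℝ} {T : Set ℝ} (h : IsCongruent s c V U T) (hV : MatC1On V T)
    (hVo : IsOrthogonalOn V T) (hUo : IsOrthogonalOn U T) (z : ℝ → n → ℝ) (u y : ℝ → m → ℝ) :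
    s.IsSolution T z u y ↔ c.IsSolution T (fun t => (V t)ᵀ *ᵥ z t) (fun t => (U t)ᵀ *ᵥ u t)
      (fun t => (U t)ᵀ *ᵥ y t) := by
  have hVz : ∀ t ∈ T, z t = V t *ᵥ ((V t)ᵀ *ᵥ z t) := fun t ht => by
    rw [mulVec_mulVec, (hVo t ht).2, one_mulVec]
  have hcancelV : ∀ t ∈ T, ∀ x w : n → ℝ, (V t)ᵀ *ᵥ x = (V t)ᵀ *ᵥ w ↔ x = w := by
    refine fun t ht x w => ⟨fun hxw => ?_, fun hxw => by rw [hxw]⟩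
    have := congrArg (fun v => V t *ᵥ v) hxw
    simpa only [mulVec_mulVec, (hVo t ht).2, one_mulVec] using this
  have hcancelU : ∀ t ∈ T, ∀ x w : m → ℝ, (U t)ᵀ *ᵥ x = (U t)ᵀ *ᵥ w ↔ x = w := by
    refine fun t ht x w => ⟨fun hxw => ?_, fun hxw => by rw [hxw]⟩
    have := congrArg (fun v => U t *ᵥ v) hxw
    simpa only [mulVec_mulVec, (hUo t ht).2, one_mulVec] using this
  have hC1 : ContDiffOn ℝ 1 z T ↔ ContDiffOn ℝ 1 (fun t => (V t)ᵀ *ᵥ z t) T :=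
    ⟨fun hz => hV.transpose.mulVec hz, fun hz => (hV.mulVec hz).congr hVz⟩
  refine and_congr ?_ (forall₂_congr fun t ht => ?_)
  · unfold LTVSystem.IsStateSolution
    rw [hC1]
    refine and_congr_right fun hzhat => ?_
    refine forall₂_congr fun t ht => ?_
    have hzder : derivWithin z T t = matDeriv V T t *ᵥ ((V t)ᵀ *ᵥ z t) +
        V t *ᵥ derivWithin (fun t => (V t)ᵀ *ᵥ z t) T t := by
      rw [← derivWithin_mulVec hV hzhat ht]
      exact derivWithin_congr hVz (hVz t ht)
    rw [← hcancelV t ht, h.E_eq t ht, h.A_eq t ht, h.G_eq t ht, hzder]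
    have hGu : ((V t)ᵀ * s.G t * U t) *ᵥ ((U t)ᵀ *ᵥ u t) = (V t)ᵀ *ᵥ (s.G t *ᵥ u t) := by
      rw [mulVec_mulVec, Matrix.mul_assoc, (hUo t ht).2, Matrix.mul_one, mulVec_mulVec]
    have hAz : ((V t)ᵀ * s.A t * V t) *ᵥ ((V t)ᵀ *ᵥ z t) = (V t)ᵀ *ᵥ (s.A t *ᵥ z t) := by
      rw [mulVec_mulVec, Matrix.mul_assoc, (hVo t ht).2, Matrix.mul_one, mulVec_mulVec]
    rw [hGu, sub_mulVec, hAz, mulVec_add (s.E t), mulVec_add, mulVec_add]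
    simp only [← mulVec_mulVec]
    rw [sub_add_eq_add_sub, eq_sub_iff_add_eq, add_comm]
  · rw [← hcancelU t ht, h.G_eq t ht, transpose_mul, transpose_mul, transpose_transpose,
      mulVec_mulVec, mulVec_mulVec, Matrix.mul_assoc _ _ (V t)ᵀ, Matrix.mul_assoc _ _ (V t)ᵀ,
      (hVo t ht).2, Matrix.mul_one]

/-! ### Consequences of the condensed form -/

section CondensedForm

variable {d : Fin 6 → ℕ} {e : Fin 3 → ℕ} {c : LTVSystem (BlockIdx d) (BlockIdx e)} {T : Set ℝ}

theorem patternE_eq_zero_of_le_left {i : Fin 6} (hi : 2 ≤ i) (j : Fin 6) : patternE i j = 0 := by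
  fin_cases i <;> fin_cases j <;> first | rfl | exact absurd hi (by decide)

theorem patternE_eq_zero_of_le_right (i : Fin 6) {j : Fin 6} (hj : 2 ≤ j) : patternE i j = 0 := by
  fin_cases i <;> fin_cases j <;> first | rfl | exact absurd hj (by decide)

theorem patternK_eq_zero_of_le_right (i : Fin 6) {j : Fin 6} (hj : 4 ≤ j) : patternK i j = 0 := by
  fin_cases i <;> fin_cases j <;> first | rfl | exact absurd hj (by decide)

theorem le_or_le_of_patternE_eq_zero {i j : Fin 6} (h : patternE i j = 0) : 2 ≤ i ∨ 2 ≤ j := by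
  fin_cases i <;> fin_cases j <;> first | decide | exact absurd h one_ne_zero

theorem le_or_le_of_patternR_eq_zero {i j : Fin 6} (h : patternR i j = 0) : 3 ≤ i ∨ 3 ≤ j := by
  fin_cases i <;> fin_cases j <;> first | decide | exact absurd h one_ne_zero

theorem le_or_le_of_patternK_eq_zero {i j : Fin 6} (h : patternK i j = 0) : 2 ≤ i ∨ 2 ≤ j := by
  fin_cases i <;> fin_cases j <;> first | decide | exact absurd h one_ne_zero

theorem cases_of_patternG_eq_zero {i : Fin 6} {j : Fin 3} (h : patternG i j = 0) :
    (i = 3 ∧ j = 0) ∨ (i = 4 ∧ j ≠ 2) ∨ (i = 5 ∧ j ≠ 2) := by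
  fin_cases i <;> fin_cases j <;> first | decide | exact absurd h one_ne_zero

theorem cases_of_patternJ_eq_zero {i j : Fin 6} (h : patternJ i j = 0) :
    i = 5 ∨ j = 5 ∨ (i = 4 ∧ j = 1) ∨ (i = 1 ∧ j = 4) ∨
      (2 ≤ i ∧ 2 ≤ j ∧ (3 ≤ i ∨ 3 ≤ j)) := by
  fin_cases i <;> fin_cases j <;> first | decide | exact absurd h one_ne_zero

/-- EK contributes nothing here: either the row of E or the column of K vanishes. -/
theorem IsCondensedForm.A_apply (hc : IsCondensedForm c T) {t : ℝ} (ht : t ∈ T) {x y : BlockIdx d}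
    (h : 2 ≤ x.1 ∨ 4 ≤ y.1) : c.A t x y = c.J t x y - c.R t x y := by
  obtain ⟨i, a⟩ := x
  obtain ⟨j, b⟩ := y
  rw [LTVSystem.A, Matrix.sub_apply, Matrix.sub_apply, sub_eq_self, Matrix.mul_apply]
  refine Finset.sum_eq_zero fun w _ => ?_
  rcases h with h | h
  · rw [(hc.E_pattern t ht).apply (patternE_eq_zero_of_le_left h _), zero_mul]
  · rw [(hc.K_pattern t ht).apply (patternK_eq_zero_of_le_right _ h), mul_zero]

/-- The corresponding blocks of E' and EK vanish, so the port-Hamiltonian identity reduces to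
skewness of J there. -/
theorem IsCondensedForm.blk_J_four_zero (hc : IsCondensedForm c T) (hs : c.IsPHDAE T) {t : ℝ}
    (ht : t ∈ T) : blk (c.J t) 4 0 = -(blk (c.J t) 0 4)ᵀ := by
  ext a b
  have h := congrFun (congrFun (hs.skew_adjoint t ht) ⟨0, b⟩) ⟨4, a⟩
  have hE : matDeriv c.E T t ⟨0, b⟩ ⟨4, a⟩ = 0 := by
    rw [matDeriv, of_apply, derivWithin_congr (f := fun _ => (0 : ℝ))
      (fun s hs => (hc.E_pattern s hs).apply rfl)
      ((hc.E_pattern t ht).apply rfl)]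
    simp
  have h1 := hc.A_apply ht (x := ⟨0, b⟩) (y := ⟨4, a⟩) (Or.inr le_rfl)
  have h2 := hc.A_apply ht (x := ⟨4, a⟩) (y := ⟨0, b⟩)
    (Or.inl (by decide : (2 : Fin 6) ≤ 4))
  rw [LTVSystem.A, Matrix.sub_apply, Matrix.sub_apply, sub_eq_self] at h1 h2
  rw [hE, Matrix.add_apply, transpose_apply, Matrix.sub_apply, Matrix.sub_apply, h1, h2] at h
  simp only [blk, of_apply, Matrix.neg_apply, transpose_apply]
  linarith

/-- The sixth block row reads 0 = G₆₃u₃. With u₃ = 0 the fifth reads 0 = J₅₁z₁, where J₅₁ = -J₁₅ᵀ is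
invertible. -/
theorem IsCondensedForm.input_and_state_eq_zero (hc : IsCondensedForm c T) (hs : c.IsPHDAE T)
    {z : ℝ → BlockIdx d → ℝ} {u : ℝ → BlockIdx e → ℝ} (hz : c.IsStateSolution T z u) {t : ℝ}
    (ht : t ∈ T) : (∀ a, u t ⟨2, a⟩ = 0) ∧ (∀ a, z t ⟨0, a⟩ = 0) := by
  have hrow : ∀ (i : Fin 6) (a : Fin (d i)), 2 ≤ i →
      0 = (c.A t *ᵥ z t) ⟨i, a⟩ + (c.G t *ᵥ u t) ⟨i, a⟩ := by
    intro i a hi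
    have h := congrFun (hz.2 t ht) ⟨i, a⟩
    rw [Pi.add_apply] at h
    rw [← h, Matrix.mulVec, dotProduct, eq_comm]
    refine Finset.sum_eq_zero fun w _ => ?_
    rw [(hc.E_pattern t ht).apply (patternE_eq_zero_of_le_left hi _), zero_mul]
  have hA : ∀ (i j : Fin 6), 2 ≤ i → patternJ i j = 0 → patternR i j = 0 →
      blk (c.A t) i j = 0 := by
    intro i j hi hJ hR
    ext a b
    rw [blk, of_apply, hc.A_apply ht (Or.inl hi), (hc.J_pattern t ht).apply hJ,
      (hc.R_pattern t ht).apply hR, sub_zero, Matrix.zero_apply]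
  have hu : (fun b => u t ⟨2, b⟩) = 0 := by
    refine (hc.G63_inv t ht).eq_zero_of_mulVec ?_
    ext a
    have h := hrow 5 a (by decide)
    rw [mulVec_apply_eq_sum_blk, mulVec_apply_eq_sum_blk, Fin.sum_univ_six, Fin.sum_univ_three,
      hA 5 0 (by decide) rfl rfl, hA 5 1 (by decide) rfl rfl, hA 5 2 (by decide) rfl rfl,
      hA 5 3 (by decide) rfl rfl, hA 5 4 (by decide) rfl rfl, hA 5 5 (by decide) rfl rfl,
      hc.G_pattern t ht 5 0 rfl, hc.G_pattern t ht 5 1 rfl] at h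
    simpa using h.symm
  refine ⟨fun a => congrFun hu a, fun a => ?_⟩
  have hinv := (hc.J15_inv t ht).neg_transpose
  rw [← hc.blk_J_four_zero hs ht] at hinv
  refine congrFun (hinv.eq_zero_of_mulVec (x := fun b => z t ⟨0, b⟩) ?_) a
  have hA40 : blk (c.A t) 4 0 = blk (c.J t) 4 0 := by
    ext a b
    rw [blk, of_apply, hc.A_apply ht (Or.inl (by decide : (2 : Fin 6) ≤ 4)),
      (hc.R_pattern t ht).apply rfl, sub_zero]
    rfl
  ext a
  have h := hrow 4 a (by decide)
  rw [mulVec_apply_eq_sum_blk, mulVec_apply_eq_sum_blk, Fin.sum_univ_six, Fin.sum_univ_three,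
    hA40, hA 4 1 (by decide) rfl rfl, hA 4 2 (by decide) rfl rfl,
    hA 4 3 (by decide) rfl rfl, hA 4 4 (by decide) rfl rfl, hA 4 5 (by decide) rfl rfl,
    hc.G_pattern t ht 4 0 rfl, hc.G_pattern t ht 4 1 rfl, hu] at h
  simpa using h.symm

/-- E sees only derivatives of the first two blocks, which agree; the first block row of the
difference is then J₁₅ times the difference of the fifth blocks. -/
theorem IsCondensedForm.eqOn_of_eq_off_four (hc : IsCondensedForm c T)
    {z w : ℝ → BlockIdx d → ℝ} {u : ℝ → BlockIdx e → ℝ} (hz : c.IsStateSolution T z u)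
    (hw : c.IsStateSolution T w u)
    (hzw : ∀ t ∈ T, ∀ i, i ≠ 4 → ∀ a, z t ⟨i, a⟩ = w t ⟨i, a⟩) : Set.EqOn z w T := by
  intro t ht
  have hder : ∀ i, i ≠ 4 → ∀ a, derivWithin z T t ⟨i, a⟩ = derivWithin w T t ⟨i, a⟩ := by
    intro i hi a
    rw [derivWithin_pi fun x => (contDiffOn_pi.1 hz.1 x).differentiableOn one_ne_zero t ht,
      derivWithin_pi fun x => (contDiffOn_pi.1 hw.1 x).differentiableOn one_ne_zero t ht]
    exact derivWithin_congr (fun s hs => hzw s hs i hi a) (hzw t ht i hi a)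
  have hE : c.E t *ᵥ derivWithin z T t = c.E t *ᵥ derivWithin w T t := by
    ext x
    rw [mulVec, dotProduct, mulVec, dotProduct]
    refine Finset.sum_congr rfl fun y _ => ?_
    by_cases hy : y.1 = 4
    · have : c.E t x y = 0 := (hc.E_pattern t ht).apply
        (patternE_eq_zero_of_le_right _ (by rw [hy]; decide))
      rw [this, zero_mul, zero_mul]
    · rw [hder y.1 hy y.2]
  rw [hz.2 t ht, hw.2 t ht, add_left_inj, ← sub_eq_zero,
    ← mulVec_sub] at hE
  have h4 : (fun b => (z t - w t) ⟨4, b⟩) = 0 := by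
    refine (hc.J15_inv t ht).eq_zero_of_mulVec ?_
    have hoff : ∀ i, i ≠ 4 → (fun b => (z t - w t) ⟨i, b⟩) = 0 := fun i hi => by
      ext b
      exact sub_eq_zero.2 (hzw t ht i hi b)
    have hA04 : blk (c.A t) 0 4 = blk (c.J t) 0 4 := by
      ext a b
      rw [blk, of_apply, hc.A_apply ht (Or.inr (le_refl (4 : Fin 6))),
        (hc.R_pattern t ht).apply rfl, sub_zero]
      rfl
    ext a
    have h := congrFun hE ⟨0, a⟩
    rw [mulVec_apply_eq_sum_blk, Fin.sum_univ_six, hoff 0 (by decide), hoff 1 (by decide),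
      hoff 2 (by decide), hoff 3 (by decide), hoff 5 (by decide), hA04] at h
    simpa using h
  ext ⟨i, b⟩
  by_cases hi : i = 4
  · subst hi
    exact sub_eq_zero.1 (congrFun h4 b)
  · exact hzw t ht i hi b

end CondensedForm

/-! ### The congruence transform and the choice of K -/

namespace LTVSystem

variable {n m : Type} [Fintype n]

/-- Skew-adjointness in a form where J and K enter only through `A`, so shifting terms between J and
EK preserves it. -/
theorem IsPHDAE.matDeriv_E_eq {s : LTVSystem n m} {T : Set ℝ} (hs : s.IsPHDAE T) {t : ℝ}
    (ht : t ∈ T) : matDeriv s.E T t = -(s.A t + s.R t) - (s.A t + s.R t)ᵀ := by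
  have : s.A t + s.R t = -(s.E t * s.K t - s.J t) := by rw [A]; abel
  rw [hs.skew_adjoint t ht, this, transpose_neg]
  abel

section Condense

variable [Fintype m] {d : Fin 6 → ℕ} {e : Fin 3 → ℕ}

/-- The projection onto the first two state blocks. -/
def leadProj (d : Fin 6 → ℕ) : Matrix (BlockIdx d) (BlockIdx d) ℝ :=
  diagonal fun x => if x.1 < 2 then 1 else 0

/-- The congruence transform of a system, with `K` compressed to the first two state blocks. -/
noncomputable def condense (s : LTVSystem n m) (V : ℝ → Matrix n (BlockIdx d) ℝ)
    (U : ℝ → Matrix m (BlockIdx e) ℝ) (T : Set ℝ) : LTVSystem (BlockIdx d) (BlockIdx e) where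
  E t := (V t)ᵀ * s.E t * V t
  R t := (V t)ᵀ * s.R t * V t
  G t := (V t)ᵀ * s.G t * U t
  K t := leadProj d * ((V t)ᵀ * s.K t * V t + (V t)ᵀ * matDeriv V T t) * leadProj d
  -- J is defined as A + R + EK, so that the state coefficient is the transformed one whatever K is.
  J t := ((V t)ᵀ * s.A t * V t - (V t)ᵀ * s.E t * matDeriv V T t) + (V t)ᵀ * s.R t * V t +
    (V t)ᵀ * s.E t * V t *
      (leadProj d * ((V t)ᵀ * s.K t * V t + (V t)ᵀ * matDeriv V T t) * leadProj d)

variable {s : LTVSystem n m} {V : ℝ → Matrix n (BlockIdx d) ℝ}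
  {U : ℝ → Matrix m (BlockIdx e) ℝ} {T : Set ℝ}

theorem condense_A (t : ℝ) : (s.condense V U T).A t =
    (V t)ᵀ * s.A t * V t - (V t)ᵀ * s.E t * matDeriv V T t := by
  simp only [A, condense]
  abel

/-- The product rule: the terms containing V' in the derivative of VᵀEV match those that VᵀEV' and
its transpose contribute on the right. -/
theorem condense_matDeriv_E (hs : s.IsPHDAE T) (hV : MatC1On V T) {t : ℝ} (ht : t ∈ T) :
    matDeriv (s.condense V U T).E T t =
      -((s.condense V U T).A t + (s.condense V U T).R t) -
        ((s.condense V U T).A t + (s.condense V U T).R t)ᵀ := by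
  rw [condense_A]
  simp only [condense]
  rw [matDeriv_mul (hV.transpose.mul hs.E_C1) hV ht, matDeriv_mul hV.transpose hs.E_C1 ht,
    matDeriv_transpose, hs.matDeriv_E_eq ht]
  simp only [transpose_add, transpose_sub, transpose_mul, transpose_transpose, hs.E_symm t ht,
    Matrix.mul_add, Matrix.add_mul, Matrix.mul_sub, Matrix.sub_mul, Matrix.mul_neg, Matrix.neg_mul,
    Matrix.mul_assoc]
  abel

theorem condense_isPHDAE (hT : UniqueDiffOn ℝ T) (hs : s.IsPHDAE T) (hV : MatC1On V T)
    (hU : MatC1On U T) : (s.condense V U T).IsPHDAE T := by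
  have hVc := hV.continuousOn
  have hVtc := hV.transpose.continuousOn
  have hV'c := continuousOn_matDeriv hT hV
  have hEc := hs.E_C1.continuousOn
  have hAc : ContinuousOn s.A T := (hs.J_cont.sub hs.R_cont).sub (hEc.matrix_mul hs.K_cont)
  have hKc : ContinuousOn (s.condense V U T).K T :=
    (continuousOn_const.matrix_mul (((hVtc.matrix_mul hs.K_cont).matrix_mul hVc).add
      (hVtc.matrix_mul hV'c))).matrix_mul continuousOn_const
  have hEhat : MatC1On (s.condense V U T).E T := (hV.transpose.mul hs.E_C1).mul hV
  have hRc : ContinuousOn (s.condense V U T).R T :=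
    (hVtc.matrix_mul hs.R_cont).matrix_mul hVc
  refine
    { E_C1 := hEhat
      J_cont := ((((hVtc.matrix_mul hAc).matrix_mul hVc).sub
        ((hVtc.matrix_mul hEc).matrix_mul hV'c)).add hRc).add
          (hEhat.continuousOn.matrix_mul hKc)
      R_cont := hRc
      K_cont := hKc
      G_cont := (hVtc.matrix_mul hs.G_cont).matrix_mul hU.continuousOn
      E_symm := fun t ht => ?_
      skew_adjoint := fun t ht => ?_
      R_psd := fun t ht => ?_ }
  · simp only [condense, transpose_mul, transpose_transpose, hs.E_symm t ht, Matrix.mul_assoc]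
  · have h1 : (s.condense V U T).E t * (s.condense V U T).K t - (s.condense V U T).J t =
        -((s.condense V U T).A t + (s.condense V U T).R t) := by rw [A]; abel
    rw [condense_matDeriv_E hs hV ht, h1, transpose_neg, sub_eq_add_neg]
  · have := (hs.R_psd t ht).conjTranspose_mul_mul_same (V t)
    rwa [conjTranspose_eq_transpose_of_trivial] at this

/-- The projection onto the last four state blocks. -/
def trailProj (d : Fin 6 → ℕ) : Matrix (BlockIdx d) (BlockIdx d) ℝ :=
  diagonal fun x => if x.1 < 2 then 0 else 1

theorem leadProj_eq (d : Fin 6 → ℕ) : leadProj d = 1 - trailProj d := by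
  rw [leadProj, trailProj, ← diagonal_one, diagonal_sub]
  congr 1
  ext x
  split_ifs <;> simp

/-- The coefficient `J` of the condensed system in terms of the transformed `J`. -/
theorem condense_J [DecidableEq n] (hs : s.IsPHDAE T) (hV : MatC1On V T) (hVo : IsOrthogonalOn V T)
    (hE : ∀ t ∈ T, (s.condense V U T).E t * trailProj d = 0) {t : ℝ} (ht : t ∈ T) :
    (s.condense V U T).J t = (V t)ᵀ * s.J t * V t -
      ((V t)ᵀ * s.J t * V t + ((V t)ᵀ * s.J t * V t)ᵀ) * trailProj d := by
  set E := (V t)ᵀ * s.E t * V t with hEdef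
  set J := (V t)ᵀ * s.J t * V t with hJdef
  set K := (V t)ᵀ * s.K t * V t + (V t)ᵀ * matDeriv V T t with hKdef
  have hEt : Eᵀ = E := by
    simp only [hEdef, transpose_mul, transpose_transpose, hs.E_symm t ht, Matrix.mul_assoc]
  have hEE : E * trailProj d = 0 := hE t ht
  have hcancel : ∀ {l : Type} (X : Matrix n l ℝ), V t * ((V t)ᵀ * X) = X := fun X => by
    rw [← Matrix.mul_assoc, (hVo t ht).2, Matrix.one_mul]
  have hEK : E * K = (V t)ᵀ * (s.E t * s.K t) * V t + (V t)ᵀ * s.E t * matDeriv V T t := by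
    simp only [hEdef, hKdef, Matrix.mul_add, Matrix.mul_assoc, hcancel]
  have hAR : (s.condense V U T).A t + (s.condense V U T).R t = J - E * K := by
    rw [condense_A, hEK]
    simp only [condense, A, hJdef, Matrix.mul_sub, Matrix.sub_mul]
    abel
  have hder := condense_matDeriv_E (U := U) hs hV ht
  have hEC1 : MatC1On (s.condense V U T).E T := (hV.transpose.mul hs.E_C1).mul hV
  -- The trailing columns of the transformed E vanish identically, hence so do those of its
  -- derivative. The identity for E' then expresses the trailing columns of EK by J + Jᵀ.
  have hder0 : matDeriv (s.condense V U T).E T t * trailProj d = 0 := by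
    have h := matDeriv_congr (N := fun _ => (0 : Matrix (BlockIdx d) (BlockIdx d) ℝ)) hE ht
    rw [matDeriv_mul hEC1 (MatC1On.const _ T) ht, matDeriv_const, matDeriv_const,
      Matrix.mul_zero, add_zero] at h
    exact h
  rw [hder, hAR] at hder0
  have hkey : (E * K) * trailProj d = (J + Jᵀ) * trailProj d := by
    rw [transpose_sub, transpose_mul E K, hEt] at hder0
    have h : (-(J - E * K) - (Jᵀ - Kᵀ * E)) * trailProj d =
        (E * K) * trailProj d + Kᵀ * (E * trailProj d) - (J + Jᵀ) * trailProj d := by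
      noncomm_ring
    rw [h, hEE, Matrix.mul_zero, add_zero] at hder0
    exact sub_eq_zero.1 hder0
  have hJhat : (s.condense V U T).J t = J - E * K + E * (leadProj d * K * leadProj d) := by
    rw [← hAR, condense_A]
    rfl
  have hlead : E * (leadProj d * K * leadProj d) = E * K - E * K * trailProj d := by
    rw [leadProj_eq, ← Matrix.mul_assoc, ← Matrix.mul_assoc, Matrix.mul_sub E, Matrix.mul_one, hEE,
      sub_zero, Matrix.mul_sub, Matrix.mul_one]
  rw [hJhat, hlead, hkey]
  abel

theorem condense_isCongruent [DecidableEq n] (hs : s.IsPHDAE T) (hV : MatC1On V T)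
    (hVo : IsOrthogonalOn V T)
    (hE : ∀ t ∈ T, (s.condense V U T).E t * trailProj d = 0) :
    IsCongruent s (s.condense V U T) V U T where
  E_eq _ _ := rfl
  R_eq _ _ := rfl
  A_eq t _ := condense_A t
  G_eq _ _ := rfl
  J_eq_of_skew h t ht := by
    rw [condense_J hs hV hVo hE ht, transpose_mul, transpose_mul, transpose_transpose, h t ht]
    simp [Matrix.mul_assoc]

end Condense

end LTVSystem

/-! ### Verification of the condensed form and conclusion -/

open LTVSystem

/-- Meant for N = Mᵀ, as in `condense_J`: leading block columns of the new J come from VᵀJV,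
trailing ones from minus its transpose. -/
theorem blk_sub_mul_trailProj {d : Fin 6 → ℕ} (M N : Matrix (BlockIdx d) (BlockIdx d) ℝ)
    (i j : Fin 6) :
    blk (M - (M + N) * trailProj d) i j = if j < 2 then blk M i j else -blk N i j := by
  ext a b
  simp only [blk, of_apply, Matrix.sub_apply, trailProj, mul_diagonal, Matrix.add_apply]
  split_ifs <;> simp

theorem isCondensedForm_condense {n m : Type} [Fintype n] [Fintype m] [DecidableEq n]
    [DecidableEq m] {d : Fin 6 → ℕ} {e : Fin 3 → ℕ} {s : LTVSystem n m} {T : Set ℝ}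
    (hs : s.IsPHDAE T) {F : ∀ i, ℝ → Matrix n (Fin (d i)) ℝ} {H : ∀ j, ℝ → Matrix m (Fin (e j)) ℝ}
    {P : Fin 6 → ℝ → Matrix n n ℝ} {Q : Fin 3 → ℝ → Matrix m m ℝ}
    (hsplit : ∀ t ∈ T, IsSplitting (s.E t) (s.J t) (s.R t) (s.G t) (fun i => P i t)
      (fun j => Q j t))
    (hF : ∀ t ∈ T, IsFrameFamily (fun i => F i t) (fun i => P i t))
    (hH : ∀ t ∈ T, IsFrameFamily (fun j => H j t) (fun j => Q j t))
    (hV : MatC1On (fun t => blockCols fun i => F i t) T) :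
    (∀ t ∈ T, (s.condense (fun t => blockCols fun i => F i t)
      (fun t => blockCols fun j => H j t) T).E t * trailProj d = 0) ∧
    IsCondensedForm (s.condense (fun t => blockCols fun i => F i t)
      (fun t => blockCols fun j => H j t) T) T := by
  set c := s.condense (fun t => blockCols fun i => F i t) (fun t => blockCols fun j => H j t) T
    with hc
  have hblkE : ∀ t i j, blk (c.E t) i j = (F i t)ᵀ * s.E t * F j t := fun t i j => rfl
  have hblkR : ∀ t i j, blk (c.R t) i j = (F i t)ᵀ * s.R t * F j t := fun t i j => rfl
  have hblkG : ∀ t i j, blk (c.G t) i j = (F i t)ᵀ * s.G t * H j t := fun t i j => rfl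
  have hE0 : ∀ t ∈ T, ∀ i j : Fin 6, 2 ≤ i ∨ 2 ≤ j → blk (c.E t) i j = 0 := by
    intro t ht i j hij
    rw [hblkE]
    refine (hF t ht).block_eq_zero (hF t ht) ?_
    rcases hij with h | h
    · have h0 := congrArg transpose ((hsplit t ht).E_mul i h)
      rw [transpose_mul, hs.E_symm t ht, (hsplit t ht).decompP.symm, transpose_zero] at h0
      rw [h0, zero_mul]
    · rw [mul_assoc, (hsplit t ht).E_mul j h, mul_zero]
  have hEtrail : ∀ t ∈ T, c.E t * trailProj d = 0 := by
    intro t ht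
    ext x y
    rw [trailProj, mul_diagonal, Matrix.zero_apply]
    split_ifs with h
    · rw [mul_zero]
    · rw [show c.E t x y = 0 from congrFun (congrFun
        (hE0 t ht x.1 y.1 (Or.inr (not_lt.1 h))) x.2) y.2, zero_mul]
  refine ⟨hEtrail, ?_⟩
  have hblkJ : ∀ t ∈ T, ∀ i j, blk (c.J t) i j =
      if j < 2 then (F i t)ᵀ * s.J t * F j t else -((F j t)ᵀ * s.J t * F i t)ᵀ := by
    intro t ht i j
    rw [hc, condense_J hs hV (fun t ht => (hF t ht).blockCols_orthogonal) hEtrail ht,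
      blk_sub_mul_trailProj]
    rfl
  have hR0 : ∀ t ∈ T, ∀ i j : Fin 6, 3 ≤ i ∨ 3 ≤ j → blk (c.R t) i j = 0 := by
    intro t ht i j hij
    rw [hblkR]
    refine (hF t ht).block_eq_zero (hF t ht) ?_
    rcases hij with h | h
    · have h0 := congrArg transpose ((hsplit t ht).R_mul i h)
      have hRs := (hs.R_psd t ht).1
      rw [IsHermitian, conjTranspose_eq_transpose_of_trivial] at hRs
      rw [transpose_mul, hRs, (hsplit t ht).decompP.symm, transpose_zero] at h0
      rw [h0, zero_mul]
    · rw [mul_assoc, (hsplit t ht).R_mul j h, mul_zero]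
  have hJblk0 : ∀ t ∈ T, ∀ i j, P i t * s.J t * P j t = 0 → (F i t)ᵀ * s.J t * F j t = 0 :=
    fun t ht i j h => (hF t ht).block_eq_zero (hF t ht) h
  have hJinv : ∀ t ∈ T, IsInvertibleMatrix ((F 4 t)ᵀ * s.J t * F 0 t) := fun t ht =>
    (hF t ht).isInvertibleMatrix_block (hF t ht) (hsplit t ht).inj_J (hsplit t ht).inj_JT
  exact
    { E_pattern := fun t ht i j hij => hE0 t ht i j (le_or_le_of_patternE_eq_zero hij)
      J_pattern := fun t ht i j hij => by
        have hsp := hsplit t ht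
        have h5 : ∀ k, (F 5 t)ᵀ * s.J t * F k t = 0 := fun k =>
          hJblk0 t ht 5 k (by rw [hsp.five_J, zero_mul])
        have h41 : (F 4 t)ᵀ * s.J t * F 1 t = 0 := hJblk0 t ht 4 1 hsp.four_J_one
        have hN : ∀ i j : Fin 6, 2 ≤ i → 2 ≤ j → 3 ≤ i ∨ 3 ≤ j → (F i t)ᵀ * s.J t * F j t = 0 :=
          fun i j hi hj h => hJblk0 t ht i j (hsp.mul_J_mul i j hi hj h)
        rw [hblkJ t ht]
        rcases cases_of_patternJ_eq_zero hij with rfl | rfl | ⟨rfl, rfl⟩ | ⟨rfl, rfl⟩ | ⟨hi, hj, h⟩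
        · split_ifs with hj
          · exact h5 j
          · rw [hN j 5 (not_lt.1 hj) (by decide) (Or.inr (by decide)), transpose_zero, neg_zero]
        · rw [if_neg (by decide), h5, transpose_zero, neg_zero]
        · rw [if_pos (by decide), h41]
        · rw [if_neg (by decide), h41, transpose_zero, neg_zero]
        · rw [if_neg (not_lt.2 hj), hN j i hj hi h.symm, transpose_zero, neg_zero]
      R_pattern := fun t ht i j hij => hR0 t ht i j (le_or_le_of_patternR_eq_zero hij)
      K_pattern := fun t ht i j hij => by
        ext a b
        simp only [blk, of_apply, c, condense, leadProj, mul_diagonal, diagonal_mul,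
          Matrix.zero_apply]
        rcases le_or_le_of_patternK_eq_zero hij with h | h
        · rw [if_neg (not_lt.2 h), zero_mul, zero_mul]
        · rw [if_neg (not_lt.2 h), mul_zero]
      G_pattern := fun t ht i j hij => by
        have hsp := hsplit t ht
        rw [hblkG]
        refine (hF t ht).block_eq_zero (hH t ht) ?_
        rcases cases_of_patternG_eq_zero hij with ⟨rfl, rfl⟩ | ⟨rfl, h⟩ | ⟨rfl, h⟩
        · exact hsp.three_G_zero
        · exact hsp.four_G j h
        · exact hsp.five_G j h
      E22_inv := fun t ht => isInvertibleMatrix_of_injective fun x hx =>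
        (hF t ht).eq_zero_of_block_mulVec (hF t ht) (hsplit t ht).inj_E hx
      JR33_inv := fun t ht => by
        have hsp := hsplit t ht
        -- Block column three carries -Jᵀ; skewness on ker E turns it back into J, so `inj_JR`
        -- applies.
        have h0 := (hF t ht).block_eq_zero (hF t ht) (hsp.skew 2 2 le_rfl le_rfl)
        rw [Matrix.mul_add, Matrix.add_mul] at h0
        have hblk : blk (c.J t - c.R t) 2 2 = (F 2 t)ᵀ * (s.J t - s.R t) * F 2 t := by
          have h1 : blk (c.J t - c.R t) 2 2 = blk (c.J t) 2 2 - blk (c.R t) 2 2 := rfl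
          rw [h1, hblkJ t ht, if_neg (by decide), hblkR, transpose_mul, transpose_mul,
            transpose_transpose, ← Matrix.mul_assoc, ← eq_neg_of_add_eq_zero_left h0,
            Matrix.mul_sub, Matrix.sub_mul]
        rw [hblk]
        exact isInvertibleMatrix_of_injective fun x hx =>
          (hF t ht).eq_zero_of_block_mulVec (hF t ht) hsp.inj_JR hx
      J15_inv := fun t ht => by
        rw [hblkJ t ht, if_neg (by decide)]
        exact (hJinv t ht).neg_transpose
      G42_inv := fun t ht => (hF t ht).isInvertibleMatrix_block (hH t ht) (hsplit t ht).inj_G3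
        (hsplit t ht).inj_G3T
      G63_inv := fun t ht => (hF t ht).isInvertibleMatrix_block (hH t ht) (hsplit t ht).inj_G5
        (hsplit t ht).inj_G5T }

theorem mainTheorem5 (t₀ t₁ : ℝ) (ht : t₀ < t₁) (n₁ n₂ m : ℕ)
    (s₁ : LTVSystem (Fin n₁) (Fin m)) (G₂ : ℝ → Matrix (Fin n₂) (Fin m) ℝ)
    (hpH : (s₁.augment G₂).IsPHDAE (Set.Icc t₀ t₁))
    (hH : ∀ t ∈ Set.Icc t₀ t₁, ∀ z, 0 ≤ (s₁.augment G₂).hamiltonian t z)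
    (hJ : MatC1On s₁.J (Set.Icc t₀ t₁)) (hR : MatC1On s₁.R (Set.Icc t₀ t₁))
    (hG₁ : MatC1On s₁.G (Set.Icc t₀ t₁)) (hG₂ : MatC1On G₂ (Set.Icc t₀ t₁))
    (hreg : s₁.IsRegular t₀ t₁)
    (hfull : ∀ t ∈ Set.Icc t₀ t₁, (G₂ t).rank = n₂)
    (hrank : (s₁.augment G₂).HasConstantRanks (Set.Icc t₀ t₁)) :
    ∃ (d : Fin 6 → ℕ) (e : Fin 3 → ℕ)
      (V : ℝ → Matrix (Fin n₁ ⊕ Fin n₂) (BlockIdx d) ℝ)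
      (U : ℝ → Matrix (Fin m) (BlockIdx e) ℝ)
      (c : LTVSystem (BlockIdx d) (BlockIdx e)),
      MatC1On V (Set.Icc t₀ t₁) ∧ IsOrthogonalOn V (Set.Icc t₀ t₁) ∧
      MatC1On U (Set.Icc t₀ t₁) ∧ IsOrthogonalOn U (Set.Icc t₀ t₁) ∧
      IsCongruent (s₁.augment G₂) c V U (Set.Icc t₀ t₁) ∧
      (∀ (z : ℝ → Fin n₁ ⊕ Fin n₂ → ℝ) (u y : ℝ → Fin m → ℝ),
        (s₁.augment G₂).IsSolution (Set.Icc t₀ t₁) z u y ↔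
          c.IsSolution (Set.Icc t₀ t₁) (fun t => (V t)ᵀ *ᵥ z t) (fun t => (U t)ᵀ *ᵥ u t)
            (fun t => (U t)ᵀ *ᵥ y t)) ∧
      c.IsPHDAE (Set.Icc t₀ t₁) ∧
      IsCondensedForm c (Set.Icc t₀ t₁) ∧
      (∀ z u y, c.IsSolution (Set.Icc t₀ t₁) z u y → ∀ t ∈ Set.Icc t₀ t₁,
        (∀ a, u t ⟨2, a⟩ = 0) ∧ (∀ a, z t ⟨0, a⟩ = 0)) ∧
      (∀ z w u y, c.IsSolution (Set.Icc t₀ t₁) z u y → c.IsSolution (Set.Icc t₀ t₁) w u y →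
        (∀ t ∈ Set.Icc t₀ t₁, ∀ i, i ≠ 4 → ∀ a, z t ⟨i, a⟩ = w t ⟨i, a⟩) →
        Set.EqOn z w (Set.Icc t₀ t₁)) := by
  obtain ⟨P, Q, hP, hQ, hsplit⟩ := exists_splitting ht hpH hH hJ hR hG₁ hG₂ hreg hfull hrank
  choose d F hF1 hF using fun i => (hP i).exists_frame ht
    (fun t ht => (hsplit t ht).decompP.symm i) (fun t ht => (hsplit t ht).decompP.idem i)
  choose e H hH1 hH using fun j => (hQ j).exists_frame ht
    (fun t ht => (hsplit t ht).decompQ.symm j) (fun t ht => (hsplit t ht).decompQ.idem j)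
  have hFF : ∀ t ∈ Set.Icc t₀ t₁, IsFrameFamily (fun i => F i t) (fun i => P i t) := fun t ht =>
    ⟨(hsplit t ht).decompP, fun i => (hF i t ht).1, fun i => (hF i t ht).2⟩
  have hHH : ∀ t ∈ Set.Icc t₀ t₁, IsFrameFamily (fun j => H j t) (fun j => Q j t) := fun t ht =>
    ⟨(hsplit t ht).decompQ, fun j => (hH j t ht).1, fun j => (hH j t ht).2⟩
  have hV : MatC1On (fun t => blockCols fun i => F i t) (Set.Icc t₀ t₁) :=
    fun a x => hF1 x.1 a x.2
  have hU : MatC1On (fun t => blockCols fun j => H j t) (Set.Icc t₀ t₁) :=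
    fun a x => hH1 x.1 a x.2
  have hVo : IsOrthogonalOn (fun t => blockCols fun i => F i t) (Set.Icc t₀ t₁) :=
    fun t ht => (hFF t ht).blockCols_orthogonal
  have hUo : IsOrthogonalOn (fun t => blockCols fun j => H j t) (Set.Icc t₀ t₁) :=
    fun t ht => (hHH t ht).blockCols_orthogonal
  obtain ⟨hE, hcond⟩ := isCondensedForm_condense hpH hsplit hFF hHH hV
  have hcong := condense_isCongruent hpH hV hVo hE
  have hpHc := condense_isPHDAE (uniqueDiffOn_Icc ht) hpH hV hU
  exact ⟨d, e, _, _, _, hV, hVo, hU, hUo, hcong, hcong.isSolution_iff hV hVo hUo, hpHc, hcond,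
    fun z u y hz t ht => hcond.input_and_state_eq_zero hpHc hz.1 ht,
    fun z w u y hz hw hzw => hcond.eqOn_of_eq_off_four hz.1 hw.1 hzw⟩
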